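/- A generalized Santha–Vazirani (GSV) source $(\mathcal F,\mathcal D)$ consists of a finite set $\mathcal F$ of faces and a finite nonempty set $\mathcal D$ of probability distributions (dice) on $\mathcal F$, such that each face has positive probability under at least one die. A random sequence $(F_1,\dots,F_n)\in\mathcal F^n$ is admissible for the source if it is generated by a strategy: for each $i$, a die $d\in\mathcal D$ is chosen as a function of $F_1,\dots,F_{i-1}$, and $F_i$ is sampled from $d$. The source satisfies $\mathrm{NK}^+$ if there is a function $\psi\colon\mathcal F\to[-1,1]$ such that $\mathbb E_d[\psi(F)]=0$ and $\mathrm{Var}_d[\psi(F)]>0$ for every die $d\in\mathcal D$. It is extractable with error $\varepsilon$ from $n$ samples if there is a function $\mathrm{Ext}\colon\mathcal F^n\to\{-1,1\}$ with $|\mathbb E[\mathrm{Ext}(F_1,\dots,F_n)]|\le\varepsilon$ for every admissible $(F_1,\dots,F_n)$. A function $\mathrm{Ext}\colon\mathcal F^n\to\{0,1\}^m$ extracts $m$ bits with error $\varepsilon$ if, for every admissible $(F_1,\dots,F_n)$, the total variation distance between the distribution of $\mathrm{Ext}(F_1,\dots,F_n)$ and the uniform distribution on $\{0,1\}^m$ is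 at most $\varepsilon$. Running time is counted on a real RAM: a finite program with integer and real variables and arrays and finitely many real constants, in which integer addition, subtraction and halving, real field operations, comparisons and memory accesses have unit cost. Theorem. There is a universal constant $c$ such that for every GSV source $(\mathcal F,\mathcal D)$ the following conditions are equivalent: 1. $(\mathcal F,\mathcal D)$ satisfies $\mathrm{NK}^+$. 2. There is a function $N(\varepsilon)$ with $N(\varepsilon)=o(1/\varepsilon^2)$ as $\varepsilon\to0^+$ such that for every $\varepsilon>0$, $(\mathcal F,\mathcal D)$ is extractable with error $\varepsilon$ from $N(\varepsilon)$ samples. 3. There are a real RAM program $P$ and constants $C,K$ (all depending only on the source) such that for every $0<\varepsilon<1$ and every integer $m\ge1$ there are a number of samples $n\le C(\log(1/\varepsilon)+m)$ and a function $\mathrm{Ext}\colon\mathcal F^n\to\{0,1\}^m$ that extracts $m$ bits with error $\varepsilon$, and $P$, given $n$, $m$ and the samples, computes $\mathrm{Ext}$ in time at most $\min\{K\,n\,m\,2^m,\; n^{c|\mathcal F|}\}$. -/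

import Mathlib

open Filter Topology Asymptotics

/-! ### Generalized Santha-Vazirani sources -/

/-- A generalized Santha-Vazirani source on the finite set of faces `F`: a finite nonempty set of
dice, each of them a probability distribution on `F`, such that each face has positive probability
under at least one die. -/
structure GSVSource (F : Type*) [Fintype F] where
  dice : Finset (F → ℝ)
  dice_nonempty : dice.Nonempty
  isDistribution : ∀ d ∈ dice, d ∈ stdSimplex ℝ F
  covers : ∀ f : F, ∃ d ∈ dice, 0 < d f

/-- Expectation of `ψ` under the die `d`. -/
def dieMean {F : Type*} [Fintype F] (d ψ : F → ℝ) : ℝ := ∑ f, d f * ψ f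

/-- Variance of `ψ` under the die `d`. -/
def dieVar {F : Type*} [Fintype F] (d ψ : F → ℝ) : ℝ := ∑ f, d f * (ψ f - dieMean d ψ) ^ 2

/-- The law of `n` samples produced by the strategy `A`, which maps the outcomes
seen so far to the next die: the probability of the outcome sequence `x` is
`∏ i, A (x 0, …, x (i - 1)) (x i)`. -/
def strategyProb {F : Type*} (A : List F → F → ℝ) {n : ℕ} (x : Fin n → F) : ℝ :=
  ∏ i : Fin n, A ((List.ofFn x).take i) (x i)

namespace GSVSource

variable {F : Type*} [Fintype F]

/-- Nonzero kernel positive variance condition. -/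
def NKPlus (S : GSVSource F) : Prop :=
  ∃ ψ : F → ℝ, (∀ f, ψ f ∈ Set.Icc (-1 : ℝ) 1) ∧
    ∀ d ∈ S.dice, dieMean d ψ = 0 ∧ 0 < dieVar d ψ

/-- A strategy of the source always tosses one of the dice of the source. -/
def IsStrategy (S : GSVSource F) (A : List F → F → ℝ) : Prop :=
  ∀ l : List F, A l ∈ S.dice

/-- The source is extractable (one bit, with values `±1`) with error `ε` from `n` samples. -/
def Extractable (S : GSVSource F) (ε : ℝ) (n : ℕ) : Prop :=
  ∃ Ext : (Fin n → F) → ℝ, (∀ x, Ext x = -1 ∨ Ext x = 1) ∧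
    ∀ A : List F → F → ℝ, S.IsStrategy A → |∑ x, strategyProb A x * Ext x| ≤ ε

/-- Probability that the extractor `Ext` outputs the bit string `y` when the samples are produced
by the strategy `A`. -/
def outputProb {n m : ℕ} (Ext : (Fin n → F) → (Fin m → Bool)) (A : List F → F → ℝ)
    (y : Fin m → Bool) : ℝ :=
  ∑ x with Ext x = y, strategyProb A x

/-- `Ext` extracts `m` bits with error `ε`: against each strategy, its output is at total variation
distance at most `ε` from the uniform distribution on `{0,1}^m`. -/
def IsExtractor (S : GSVSource F) (ε : ℝ) {n m : ℕ} (Ext : (Fin n → F) → (Fin m → Bool)) : Prop :=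
  ∀ A : List F → F → ℝ, S.IsStrategy A →
    (1 / 2 : ℝ) * ∑ y : Fin m → Bool, |outputProb Ext A y - 1 / 2 ^ m| ≤ ε

end GSVSource

/-! ### Real RAM programs

Programs have finitely many variables and unboundedly long arrays, holding natural numbers or real
numbers. Integer operations (addition, truncated subtraction, halving), real field operations,
comparisons and memory accesses take unit time. Arrays are indexed by natural numbers; there is no
conversion between natural and real numbers. A program is one finite text, and it may mention
finitely many real constants. -/

namespace RealRAM

/-- Memory contents: variables and arrays of each of the two types, all referred to by name. -/
structure State where
  natVar : ℕ → ℕ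
  natArr : ℕ → ℕ → ℕ
  realVar : ℕ → ℝ
  realArr : ℕ → ℕ → ℝ

/-- Expressions with natural number values. `get a i` is the `i`-th entry of the array `a`. -/
inductive NatExpr where
  | const (k : ℕ)
  | var (x : ℕ)
  | get (a : ℕ) (i : NatExpr)
  | add (e₁ e₂ : NatExpr)
  | sub (e₁ e₂ : NatExpr)
  | half (e : NatExpr)

/-- Expressions with real values. -/
inductive RealExpr where
  | const (r : ℝ)
  | var (x : ℕ)
  | get (a : ℕ) (i : NatExpr)
  | add (e₁ e₂ : RealExpr)
  | sub (e₁ e₂ : RealExpr)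
  | mul (e₁ e₂ : RealExpr)
  | div (e₁ e₂ : RealExpr)

/-- Conditions. -/
inductive Cond where
  | natLt (e₁ e₂ : NatExpr)
  | natEq (e₁ e₂ : NatExpr)
  | realLt (e₁ e₂ : RealExpr)
  | realEq (e₁ e₂ : RealExpr)
  | neg (b : Cond)
  | conj (b₁ b₂ : Cond)

/-- Programs: assignments, sequencing, branching and while loops. -/
inductive Program where
  | skip
  | setNat (x : ℕ) (e : NatExpr)
  | setNatArr (a : ℕ) (i e : NatExpr)
  | setReal (x : ℕ) (e : RealExpr)
  | setRealArr (a : ℕ) (i : NatExpr) (e : RealExpr)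
  | seq (p q : Program)
  | cond (b : Cond) (p q : Program)
  | loop (b : Cond) (p : Program)

/-- Value of an expression. -/
def NatExpr.eval (s : State) : NatExpr → ℕ
  | .const k => k
  | .var x => s.natVar x
  | .get a i => s.natArr a (i.eval s)
  | .add e₁ e₂ => e₁.eval s + e₂.eval s
  | .sub e₁ e₂ => e₁.eval s - e₂.eval s
  | .half e => e.eval s / 2

/-- Number of operations in an expression. -/
def NatExpr.cost : NatExpr → ℕ
  | .const _ => 1
  | .var _ => 1
  | .get _ i => i.cost + 1
  | .add e₁ e₂ => e₁.cost + e₂.cost + 1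
  | .sub e₁ e₂ => e₁.cost + e₂.cost + 1
  | .half e => e.cost + 1

/-- Value of an expression. -/
noncomputable def RealExpr.eval (s : State) : RealExpr → ℝ
  | .const r => r
  | .var x => s.realVar x
  | .get a i => s.realArr a (i.eval s)
  | .add e₁ e₂ => e₁.eval s + e₂.eval s
  | .sub e₁ e₂ => e₁.eval s - e₂.eval s
  | .mul e₁ e₂ => e₁.eval s * e₂.eval s
  | .div e₁ e₂ => e₁.eval s / e₂.eval s

/-- Number of operations in an expression. -/
def RealExpr.cost : RealExpr → ℕ
  | .const _ => 1
  | .var _ => 1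
  | .get _ i => i.cost + 1
  | .add e₁ e₂ => e₁.cost + e₂.cost + 1
  | .sub e₁ e₂ => e₁.cost + e₂.cost + 1
  | .mul e₁ e₂ => e₁.cost + e₂.cost + 1
  | .div e₁ e₂ => e₁.cost + e₂.cost + 1

/-- Truth of a condition. -/
def Cond.Holds (s : State) : Cond → Prop
  | .natLt e₁ e₂ => e₁.eval s < e₂.eval s
  | .natEq e₁ e₂ => e₁.eval s = e₂.eval s
  | .realLt e₁ e₂ => e₁.eval s < e₂.eval s
  | .realEq e₁ e₂ => e₁.eval s = e₂.eval s
  | .neg b => ¬ b.Holds s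
  | .conj b₁ b₂ => b₁.Holds s ∧ b₂.Holds s

/-- Number of operations in a condition. -/
def Cond.cost : Cond → ℕ
  | .natLt e₁ e₂ => e₁.cost + e₂.cost + 1
  | .natEq e₁ e₂ => e₁.cost + e₂.cost + 1
  | .realLt e₁ e₂ => e₁.cost + e₂.cost + 1
  | .realEq e₁ e₂ => e₁.cost + e₂.cost + 1
  | .neg b => b.cost + 1
  | .conj b₁ b₂ => b₁.cost + b₂.cost + 1

namespace State

/-- Assignment to a natural number variable. -/
def setNat (s : State) (x v : ℕ) : State :=
  { s with natVar := Function.update s.natVar x v }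

/-- Assignment to an entry of a natural number array. -/
def setNatArr (s : State) (a i v : ℕ) : State :=
  { s with natArr := Function.update s.natArr a (Function.update (s.natArr a) i v) }

/-- Assignment to a real variable. -/
def setReal (s : State) (x : ℕ) (v : ℝ) : State :=
  { s with realVar := Function.update s.realVar x v }

/-- Assignment to an entry of a real array. -/
def setRealArr (s : State) (a i : ℕ) (v : ℝ) : State :=
  { s with realArr := Function.update s.realArr a (Function.update (s.realArr a) i v) }

end State

/-- `Exec p s t s'`: started in the state `s`, the program `p` halts in the state `s'` after exactly
`t` steps. -/
inductive Exec : Program → State → ℕ → State → Prop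
  | skip (s : State) : Exec .skip s 1 s
  | setNat (s : State) (x : ℕ) (e : NatExpr) :
      Exec (.setNat x e) s (e.cost + 1) (s.setNat x (e.eval s))
  | setNatArr (s : State) (a : ℕ) (i e : NatExpr) :
      Exec (.setNatArr a i e) s (i.cost + e.cost + 1) (s.setNatArr a (i.eval s) (e.eval s))
  | setReal (s : State) (x : ℕ) (e : RealExpr) :
      Exec (.setReal x e) s (e.cost + 1) (s.setReal x (e.eval s))
  | setRealArr (s : State) (a : ℕ) (i : NatExpr) (e : RealExpr) :
      Exec (.setRealArr a i e) s (i.cost + e.cost + 1) (s.setRealArr a (i.eval s) (e.eval s))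
  | seq {p q : Program} {s s' s'' : State} {t t' : ℕ} :
      Exec p s t s' → Exec q s' t' s'' → Exec (.seq p q) s (t + t') s''
  | condTrue {b : Cond} {p q : Program} {s s' : State} {t : ℕ} :
      b.Holds s → Exec p s t s' → Exec (.cond b p q) s (b.cost + t + 1) s'
  | condFalse {b : Cond} {p q : Program} {s s' : State} {t : ℕ} :
      ¬ b.Holds s → Exec q s t s' → Exec (.cond b p q) s (b.cost + t + 1) s'
  | loopTrue {b : Cond} {p : Program} {s s' s'' : State} {t t' : ℕ} :
      b.Holds s → Exec p s t s' → Exec (.loop b p) s' t' s'' →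
        Exec (.loop b p) s (b.cost + t + t' + 1) s''
  | loopFalse {b : Cond} {p : Program} {s : State} :
      ¬ b.Holds s → Exec (.loop b p) s (b.cost + 1) s

/-- Initial memory: the natural number variables `0` and `1` hold the number `n` of samples and the
output length `m`, the natural number array `0` holds the samples (faces being numbered), and all
else is zero. -/
noncomputable def inputState {F : Type*} [Fintype F] {n : ℕ} (m : ℕ) (x : Fin n → F) : State where
  natVar v := if v = 0 then n else if v = 1 then m else 0
  natArr a i := if h : a = 0 ∧ i < n then (Fintype.equivFin F (x ⟨i, h.2⟩) : ℕ) else 0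
  realVar _ := 0
  realArr _ _ := 0

/-- The program `p`, given `n`, `m` and the samples, computes the `m` bits of the function `Ext` in
time at most `T`. The output is read from the natural number array `1`. -/
def ComputesInTime {F : Type*} [Fintype F] (p : Program) {n m : ℕ}
    (Ext : (Fin n → F) → (Fin m → Bool)) (T : ℕ) : Prop :=
  ∀ x : Fin n → F, ∃ (t : ℕ) (s : State), Exec p (inputState m x) t s ∧ t ≤ T ∧
    ∀ i : Fin m, s.natArr 1 i = (Ext x i).toNat

end RealRAM

namespace GSVSource

variable {F : Type*} [Fintype F]

/-- For each `ε > 0` the source is extractable with error `ε` from `N ε` samples, where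
`N ε = o(1/ε²)` as `ε → 0`. -/
def ExtractableSubquadratic (S : GSVSource F) : Prop :=
  ∃ N : ℝ → ℕ, (∀ ε : ℝ, 0 < ε → S.Extractable ε (N ε)) ∧
    (fun ε : ℝ => (N ε : ℝ)) =o[𝓝[>] 0] (fun ε : ℝ => 1 / ε ^ 2)

/-- Some program (which may depend on the source only), for all `0 < ε < 1` and `m ≥ 1`, extracts
`m` bits with error `ε` from some number `n ≤ C * (log (1/ε) + m)` of samples, in time at most
`min (K * n * m * 2^m) (n ^ (c * |F|))`. The constants `C` and `K` may depend on the source. -/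
def ExtractableLogarithmic (S : GSVSource F) (c : ℕ) : Prop :=
  ∃ (p : RealRAM.Program) (C : ℝ) (K : ℕ), ∀ (ε : ℝ) (m : ℕ), 0 < ε → ε < 1 → 1 ≤ m →
    ∃ (n : ℕ) (Ext : (Fin n → F) → (Fin m → Bool)),
      (n : ℝ) ≤ C * (Real.log (1 / ε) + m) ∧
      S.IsExtractor ε Ext ∧
      RealRAM.ComputesInTime p Ext (min (K * (n * m * 2 ^ m)) (n ^ (c * Fintype.card F)))

end GSVSource

/-! The cycle is 1 → 3 → 2 → 1; the first and last implications carry the content.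

Upper bound (`extractableLogarithmic_of_nkPlus`). Let `ψ` witness NK⁺ and let `σ` be its least
variance over the dice. Keep a probability distribution on the `2 ^ m` outputs, uniform at first,
and let a sample `f` multiply the mass of `y` by `1 + tilt y * ψ f`, where `tilt` has mean zero
under the current distribution. Since `ψ` has mean zero under each die, the mass of every point is a
martingale against every strategy. If the distribution ends up concentrated near one point,
outputting that point is therefore almost uniform. Concentration comes from square roots: by strict
concavity, the expected sum of `√mass` over all points but the heaviest shrinks by a factor `1 - σ /
1024` per sample, provided that `|tilt| ≥ 1/8` at these points (`sum_potential_append_le`,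
`output_error_le`). Hence `O(log (1/ε) + m)` samples suffice.

Such a tilt is the centred indicator of a set of moderate mass. The density is kept constant on
dyadic intervals; the set is an initial run of them up to the median, or the median interval alone,
halved first if that is possible. At most one interval is created per sample, so a step costs `O(min
(n + 1) (2 ^ m))`.

Lower bound (`exists_sample_lower_bound`). If NK⁺ fails, some die `d₀` has the property that every
`ψ` of mean zero under all dice vanishes on the support of `d₀`. By linear algebra, the standard
deviation `s` of any payoff under `d₀` is then bounded by a constant times the advantage of the best
die over the average die (`exists_profitable_die`). Compare two adversaries. The neutral one tosses
`d₀`, but with probability `s ^ 2` a uniformly random die; the other replaces the random die by the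
profitable one and gains at least `κ * s ^ 3` in that step. A `±1` output with value near `0` must
accumulate quadratic variation of order `1`, and each step contributes `O(s ^ 2)`, so over `n` steps
the gains add up to order `1 / √n`. This forces `ε` to be at least of order `1 / √n`. The concave
correction `1 - V ^ 2` makes the count of variation precise. -/

/-! ### Expectations under strategies and greedy adversaries -/

/-- Expectation of `W` after `n` samples produced by the strategy `A`. -/
noncomputable def stratExp {F : Type*} [Fintype F] (A : List F → F → ℝ) (n : ℕ)
    (W : List F → ℝ) : ℝ :=
  ∑ x : Fin n → F, strategyProb A x * W (List.ofFn x)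

section stratExp

variable {F : Type*} {A : List F → F → ℝ}

theorem ofFn_snoc {n : ℕ} (x : Fin n → F) (f : F) :
    List.ofFn (Fin.snoc x f : Fin (n + 1) → F) = List.ofFn x ++ [f] := by
  rw [List.ofFn_succ', List.concat_eq_append]
  simp

theorem strategyProb_snoc {n : ℕ} (x : Fin n → F) (f : F) :
    strategyProb A (Fin.snoc x f : Fin (n + 1) → F) =
      strategyProb A x * A (List.ofFn x) f := by
  unfold strategyProb
  rw [Fin.prod_univ_castSucc, ofFn_snoc]
  congr 1
  · refine Finset.prod_congr rfl fun i _ => ?_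
    have hi : (i : ℕ) ≤ (List.ofFn x).length := by simp [i.2.le]
    rw [Fin.snoc_castSucc, Fin.val_castSucc, List.take_append_of_le_length hi]
  · simp

theorem strategyProb_nonneg (hA : ∀ l f, 0 ≤ A l f) {n : ℕ} (x : Fin n → F) :
    0 ≤ strategyProb A x :=
  Finset.prod_nonneg fun _ _ => hA _ _

variable [Fintype F]

theorem stratExp_zero (W : List F → ℝ) : stratExp A 0 W = W [] := by
  simp [stratExp, strategyProb]

theorem stratExp_succ (n : ℕ) (W : List F → ℝ) :
    stratExp A (n + 1) W = stratExp A n (fun l => ∑ f, A l f * W (l ++ [f])) := by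
  unfold stratExp
  rw [← (Fin.snocEquiv fun _ : Fin (n + 1) => F).sum_comp, Fintype.sum_prod_type,
    Finset.sum_comm]
  refine Finset.sum_congr rfl fun x _ => ?_
  rw [Finset.mul_sum]
  refine Finset.sum_congr rfl fun f _ => ?_
  change strategyProb A (Fin.snoc x f : Fin (n + 1) → F) *
    W (List.ofFn (Fin.snoc x f : Fin (n + 1) → F)) = _
  rw [strategyProb_snoc, ofFn_snoc, mul_assoc]

theorem stratExp_mono (hA : ∀ l f, 0 ≤ A l f) {n : ℕ} {W W' : List F → ℝ}
    (h : ∀ l, l.length = n → W l ≤ W' l) : stratExp A n W ≤ stratExp A n W' :=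
  Finset.sum_le_sum fun x _ =>
    mul_le_mul_of_nonneg_left (h _ (by simp)) (strategyProb_nonneg hA x)

theorem stratExp_const_mul (n : ℕ) (c : ℝ) (W : List F → ℝ) :
    stratExp A n (fun l => c * W l) = c * stratExp A n W := by
  simp only [stratExp, Finset.mul_sum]
  exact Finset.sum_congr rfl fun x _ => by ring

theorem stratExp_eq_of_martingale {W : List F → ℝ}
    (h : ∀ l, ∑ f, A l f * W (l ++ [f]) = W l) (n : ℕ) : stratExp A n W = W [] := by
  induction n with
  | zero => exact stratExp_zero W
  | succ n ih => rw [stratExp_succ]; simpa only [h] using ih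

theorem stratExp_le_of_contraction (hA : ∀ l f, 0 ≤ A l f) {W : List F → ℝ} {r : ℝ} (hr : 0 ≤ r)
    (h : ∀ l, ∑ f, A l f * W (l ++ [f]) ≤ r * W l) (n : ℕ) :
    stratExp A n W ≤ r ^ n * W [] := by
  induction n with
  | zero => simp [stratExp_zero]
  | succ n ih =>
    rw [stratExp_succ]
    calc _ ≤ stratExp A n (fun l => r * W l) := stratExp_mono hA fun l _ => h l
      _ = r * stratExp A n W := stratExp_const_mul n r W
      _ ≤ r * (r ^ n * W []) := by gcongr
      _ = _ := by ring

end stratExp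

namespace GSVSource

variable {F : Type*} [Fintype F] (S : GSVSource F)

theorem die_nonneg {d : F → ℝ} (hd : d ∈ S.dice) (f : F) : 0 ≤ d f := (S.isDistribution d hd).1 f

theorem die_sum {d : F → ℝ} (hd : d ∈ S.dice) : ∑ f, d f = 1 := (S.isDistribution d hd).2

/-- A function of the number of remaining samples and the history that can be kept from decreasing
is at its root at most its expected final value under some strategy. -/
theorem exists_strategy_le (W : ℕ → List F → ℝ)
    (h : ∀ k l, ∃ d ∈ S.dice, W (k + 1) l ≤ ∑ f, d f * W k (l ++ [f])) (n : ℕ) :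
    ∃ A, S.IsStrategy A ∧ W n [] ≤ stratExp A n (W 0) := by
  choose d hd hW using h
  -- After the history `l` there remain `n - l.length` samples, and `d k` serves the step from `k +
  -- 1` to `k` remaining ones. Truncation matters only for histories of length at least `n`, which
  -- never occur.
  let A : List F → F → ℝ := fun l => d (n - l.length - 1) l
  have hA : S.IsStrategy A := fun l => hd _ _
  refine ⟨A, hA, ?_⟩
  have key : ∀ j, j ≤ n → W n [] ≤ stratExp A j (W (n - j)) := by
    intro j
    induction j with
    | zero => intro _; simp [stratExp_zero]
    | succ j ih =>
      intro hj
      refine (ih (by omega)).trans ?_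
      rw [stratExp_succ]
      refine stratExp_mono (fun l f => S.die_nonneg (hA l) f) fun l hl => ?_
      have := hW (n - (j + 1)) l
      rw [show n - (j + 1) + 1 = n - j by omega] at this
      refine this.trans_eq ?_
      simp only [A]
      rw [hl, show n - j - 1 = n - (j + 1) by omega]
  simpa using key n le_rfl

end GSVSource

/-! ### Mean and variance under one die -/

section dieMean

variable {F : Type*} [Fintype F]

/-- The expectation under a die as a linear functional. -/
noncomputable def dieMeanLin (d : F → ℝ) : (F → ℝ) →ₗ[ℝ] ℝ where
  toFun := dieMean d
  map_add' u v := by simp [dieMean, mul_add, Finset.sum_add_distrib]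
  map_smul' c v := by
    simp only [dieMean, Finset.mul_sum, Pi.smul_apply, smul_eq_mul, RingHom.id_apply]
    exact Finset.sum_congr rfl fun f _ => by ring

theorem dieMeanLin_apply (d v : F → ℝ) : dieMeanLin d v = dieMean d v := rfl

theorem dieMean_const {d : F → ℝ} (hd : ∑ f, d f = 1) (c : ℝ) : dieMean d (fun _ => c) = c := by
  simp [dieMean, ← Finset.sum_mul, hd]

theorem dieMean_mono {d : F → ℝ} (hd : ∀ f, 0 ≤ d f) {u v : F → ℝ} (h : ∀ f, u f ≤ v f) :
    dieMean d u ≤ dieMean d v :=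
  Finset.sum_le_sum fun f _ => mul_le_mul_of_nonneg_left (h f) (hd f)

theorem abs_dieMean_le {d : F → ℝ} (hd : d ∈ stdSimplex ℝ F) {v : F → ℝ} (hv : ∀ f, |v f| ≤ 1) :
    |dieMean d v| ≤ 1 := by
  rw [abs_le]
  constructor
  · rw [← dieMean_const hd.2 (-1)]
    exact dieMean_mono hd.1 fun f => (abs_le.1 (hv f)).1
  · rw [← dieMean_const hd.2 1]
    exact dieMean_mono hd.1 fun f => (abs_le.1 (hv f)).2

theorem dieMean_quadratic {d : F → ℝ} (hd : ∑ f, d f = 1) (v : F → ℝ) (p q r : ℝ) :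
    dieMean d (fun f => p * v f ^ 2 + q * v f + r) =
      p * dieMean d (fun f => v f ^ 2) + q * dieMean d v + r := by
  have : r = ∑ f, d f * r := by rw [← Finset.sum_mul, hd, one_mul]
  conv_rhs => rw [this]
  simp only [dieMean, Finset.mul_sum, ← Finset.sum_add_distrib]
  exact Finset.sum_congr rfl fun f _ => by ring

theorem dieMean_sq_sub {d : F → ℝ} (hd : ∑ f, d f = 1) (v : F → ℝ) (c : ℝ) :
    dieMean d (fun f => (v f - c) ^ 2) =
      dieMean d (fun f => v f ^ 2) - 2 * c * dieMean d v + c ^ 2 := by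
  have := dieMean_quadratic hd v 1 (-2 * c) (c ^ 2)
  rw [show (fun f => (v f - c) ^ 2) = fun f => 1 * v f ^ 2 + -2 * c * v f + c ^ 2 by
    funext f; ring, this]
  ring

theorem dieVar_eq {d : F → ℝ} (hd : ∑ f, d f = 1) (v : F → ℝ) :
    dieVar d v = dieMean d (fun f => v f ^ 2) - dieMean d v ^ 2 := by
  have := dieMean_sq_sub hd v (dieMean d v)
  change dieMean d (fun f => (v f - dieMean d v) ^ 2) = _
  rw [this]; ring

theorem dieVar_nonneg {d : F → ℝ} (hd : ∀ f, 0 ≤ d f) (v : F → ℝ) : 0 ≤ dieVar d v :=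
  Finset.sum_nonneg fun f _ => mul_nonneg (hd f) (sq_nonneg _)

theorem dieVar_le_one {d : F → ℝ} (hd : d ∈ stdSimplex ℝ F) {v : F → ℝ} (hv : ∀ f, |v f| ≤ 1) :
    dieVar d v ≤ 1 := by
  rw [dieVar_eq hd.2]
  have : dieMean d (fun f => v f ^ 2) ≤ 1 := by
    rw [← dieMean_const hd.2 1]
    exact dieMean_mono hd.1 fun f => (sq_le_one_iff_abs_le_one _).2 (hv f)
  nlinarith [sq_nonneg (dieMean d v)]

end dieMean

/-! ### Failure of NK⁺ yields a profitable die -/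

namespace GSVSource

variable {F : Type*} [Fintype F] (S : GSVSource F)

/-- The uniform average of the expectations under the dice. -/
noncomputable def avgMean (v : F → ℝ) : ℝ := (∑ d ∈ S.dice, dieMean d v) / S.dice.card

theorem card_dice_pos : (0 : ℝ) < S.dice.card := by
  exact_mod_cast S.dice_nonempty.card_pos

theorem exists_avgMean_le (v : F → ℝ) : ∃ d ∈ S.dice, S.avgMean v ≤ dieMean d v := by
  refine Finset.exists_le_of_sum_le S.dice_nonempty (le_of_eq ?_)
  have := S.card_dice_pos.ne'
  simp only [avgMean, Finset.sum_const, nsmul_eq_mul]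
  field_simp

theorem avgMean_neg (v : F → ℝ) : S.avgMean (fun f => -v f) = -S.avgMean v := by
  simp [avgMean, dieMean, neg_div]

theorem abs_avgMean_le {v : F → ℝ} (hv : ∀ f, |v f| ≤ 1) : |S.avgMean v| ≤ 1 := by
  rw [avgMean, abs_div, abs_of_pos S.card_dice_pos, div_le_one S.card_dice_pos]
  refine (Finset.abs_sum_le_sum_abs _ _).trans ?_
  calc _ ≤ ∑ d ∈ S.dice, (1 : ℝ) :=
        Finset.sum_le_sum fun d hd => abs_dieMean_le (S.isDistribution d hd) hv
    _ = _ := by simp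

/-- Some die has mean exceeding the average by a fixed fraction of the total deviation. -/
theorem exists_deviation_le (v : F → ℝ) : ∃ d ∈ S.dice,
    (∑ e ∈ S.dice, |dieMean e v - S.avgMean v|) / (2 * S.dice.card) ≤
      dieMean d v - S.avgMean v := by
  set x : (F → ℝ) → ℝ := fun d => dieMean d v - S.avgMean v
  have hcard := S.card_dice_pos
  have hx : ∑ d ∈ S.dice, x d = 0 := by
    simp only [x, Finset.sum_sub_distrib, Finset.sum_const, nsmul_eq_mul, avgMean]
    field_simp
    ring
  -- The deviations sum to zero, so their positive parts carry half of the total; some die has at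
  -- least the average positive part.
  have habs : ∑ d ∈ S.dice, |x d| = 2 * ∑ d ∈ S.dice, max (x d) 0 := by
    suffices ∑ d ∈ S.dice, |x d| = ∑ d ∈ S.dice, (2 * max (x d) 0 - x d) by
      rw [this, Finset.sum_sub_distrib, hx, sub_zero, Finset.mul_sum]
    refine Finset.sum_congr rfl fun d _ => ?_
    rcases le_total 0 (x d) with h | h
    · rw [abs_of_nonneg h, max_eq_left h]; ring
    · rw [abs_of_nonpos h, max_eq_right h]; ring
  obtain ⟨d, hd, hle⟩ := Finset.exists_le_of_sum_le (s := S.dice)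
    (f := fun _ => (∑ e ∈ S.dice, |x e|) / (2 * S.dice.card)) (g := fun d => max (x d) 0)
    S.dice_nonempty (by
      rw [Finset.sum_const, nsmul_eq_mul, habs]
      apply le_of_eq
      field_simp)
  refine ⟨d, hd, ?_⟩
  rcases le_max_iff.1 hle with h | h
  · exact h
  -- The positive part found may be the value `0`; then the total deviation is zero and so is `x d`.
  · have h0 : |x d| ≤ ∑ e ∈ S.dice, |x e| :=
      Finset.single_le_sum (f := fun e => |x e|) (fun _ _ => abs_nonneg _) hd
    have h1 : ∑ e ∈ S.dice, |x e| ≤ 0 := by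
      by_contra hc
      exact absurd h (not_le.2 (div_pos (not_le.1 hc) (by positivity)))
    have h2 : x d = 0 := abs_nonpos_iff.1 (h0.trans h1)
    change _ ≤ x d
    rwa [h2]

/-- The functions of mean zero under all dice. -/
noncomputable def kernel : Submodule ℝ (F → ℝ) := ⨅ d : S.dice, LinearMap.ker (dieMeanLin d.1)

theorem mem_kernel {ψ : F → ℝ} : ψ ∈ S.kernel ↔ ∀ d ∈ S.dice, dieMean d ψ = 0 := by
  simp [kernel, Submodule.mem_iInf, dieMeanLin_apply]

/-- The functions vanishing on the support of `d`. -/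
def vanishing (d : F → ℝ) : Submodule ℝ (F → ℝ) where
  carrier := {ψ | ∀ f, 0 < d f → ψ f = 0}
  add_mem' ha hb f hf := by simp [ha f hf, hb f hf]
  zero_mem' f hf := rfl
  smul_mem' c ψ h f hf := by simp [h f hf]

theorem dieVar_pos_of_notMem {d ψ : F → ℝ} (hd : d ∈ S.dice) (h0 : dieMean d ψ = 0)
    (h : ψ ∉ vanishing d) : 0 < dieVar d ψ := by
  obtain ⟨f, hf, hψ⟩ : ∃ f, 0 < d f ∧ ψ f ≠ 0 := by
    by_contra! hc
    exact h fun f hf => hc f hf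
  refine Finset.sum_pos' (fun g _ => mul_nonneg (S.die_nonneg hd g) (sq_nonneg _))
    ⟨f, Finset.mem_univ f, ?_⟩
  rw [h0, sub_zero]
  positivity

/-- The bound `|ψ| ≤ 1` costs nothing, by scaling; the `+ 1` avoids a division by zero. NK⁺ becomes
a statement about subspaces. -/
theorem nkPlus_of_kernel {ψ : F → ℝ} (hψ : ψ ∈ S.kernel)
    (h : ∀ d ∈ S.dice, ψ ∉ vanishing d) : S.NKPlus := by
  have hpos : 0 < ‖ψ‖ + 1 := by positivity
  have hmem : (‖ψ‖ + 1)⁻¹ • ψ ∈ S.kernel := S.kernel.smul_mem _ hψ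
  refine ⟨(‖ψ‖ + 1)⁻¹ • ψ, fun f => ?_, fun d hd => ⟨S.mem_kernel.1 hmem d hd, ?_⟩⟩
  · rw [Set.mem_Icc, ← abs_le]
    simp only [Pi.smul_apply, smul_eq_mul, abs_mul, abs_inv, abs_of_pos hpos]
    rw [inv_mul_le_one₀ hpos]
    have := norm_le_pi_norm ψ f
    rw [Real.norm_eq_abs] at this
    linarith
  · refine S.dieVar_pos_of_notMem hd (S.mem_kernel.1 hmem d hd) fun hv => h d hd ?_
    exact (Submodule.smul_mem_iff _ (inv_ne_zero hpos.ne')).1 hv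

/-- A vector space over an infinite field is not a finite union of proper subspaces. If every kernel
function vanishes on the support of some die, then one die serves all of them. -/
theorem exists_kernel_le_vanishing (h : ¬ S.NKPlus) : ∃ d ∈ S.dice, S.kernel ≤ vanishing d := by
  classical
  by_contra! hc
  let p : (F → ℝ) → Submodule ℝ S.kernel := fun d => (vanishing d).comap S.kernel.subtype
  have htop : (⊤ : Submodule ℝ S.kernel) ∉ S.dice.image p := by
    rw [Finset.mem_image]
    rintro ⟨d, hd, hp⟩
    exact hc d hd (Submodule.comap_subtype_eq_top.1 hp)
  have hne := Subspace.biUnion_ne_univ_of_top_notMem htop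
  obtain ⟨ψ, hψ⟩ := (Set.ne_univ_iff_exists_notMem _).1 hne
  refine h (S.nkPlus_of_kernel ψ.2 fun d hd hv => hψ ?_)
  simp only [Set.mem_iUnion]
  exact ⟨p d, Finset.mem_image_of_mem p hd, hv⟩

/-- If all dice give `v` the same mean, then `v` minus that constant lies in the kernel, hence
vanishes on the support of `d₀`. So the functional `v ↦ v f - dieMean d₀ v` kills the common kernel
of the deviation functionals and is a linear combination of them; `C` bounds the coefficients. -/
theorem exists_deviation_bound {d₀ : F → ℝ} (hd₀ : d₀ ∈ S.dice) (h : S.kernel ≤ vanishing d₀) :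
    ∃ C > 0, ∀ v : F → ℝ, ∀ f, 0 < d₀ f →
      |v f - dieMean d₀ v| ≤ C * ∑ d ∈ S.dice, |dieMean d v - S.avgMean v| := by
  classical
  let avgLin : (F → ℝ) →ₗ[ℝ] ℝ := (S.dice.card : ℝ)⁻¹ • ∑ d ∈ S.dice, dieMeanLin d
  have havg : ∀ v, avgLin v = S.avgMean v := fun v => by
    simp [avgLin, avgMean, dieMeanLin_apply, LinearMap.sum_apply]
    ring
  let φ : S.dice → (F → ℝ) →ₗ[ℝ] ℝ := fun d => dieMeanLin d.1 - avgLin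
  have hspan : ∀ f, ∃ c : S.dice → ℝ, 0 < d₀ f →
      ∀ v, v f - dieMean d₀ v = ∑ d, c d * (dieMean d.1 v - S.avgMean v) := by
    intro f
    by_cases hf : 0 < d₀ f
    · have hmem : (LinearMap.proj f - dieMeanLin d₀ : (F → ℝ) →ₗ[ℝ] ℝ) ∈
          Submodule.span ℝ (Set.range φ) := by
        refine mem_span_of_iInf_ker_le_ker fun v hv => ?_
        have hv' : ∀ d ∈ S.dice, dieMean d v = S.avgMean v := by
          intro d hd
          have := (Submodule.mem_iInf _).1 hv ⟨d, hd⟩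
          simpa [φ, havg, dieMeanLin_apply, sub_eq_zero] using this
        have hker : v - (fun _ => S.avgMean v) ∈ S.kernel := by
          rw [S.mem_kernel]
          intro d hd
          rw [← dieMeanLin_apply, map_sub, dieMeanLin_apply, dieMeanLin_apply,
            dieMean_const (S.die_sum hd), hv' d hd, sub_self]
        have := h hker f hf
        simp only [Pi.sub_apply] at this
        simp [dieMeanLin_apply, hv' d₀ hd₀, this]
      obtain ⟨c, hc⟩ := (Submodule.mem_span_range_iff_exists_fun ℝ).1 hmem
      refine ⟨c, fun _ v => ?_⟩
      have := congrArg (fun l : (F → ℝ) →ₗ[ℝ] ℝ => l v) hc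
      simp only [φ, LinearMap.sum_apply, LinearMap.smul_apply, LinearMap.sub_apply, havg,
        dieMeanLin_apply, smul_eq_mul, LinearMap.proj_apply] at this
      exact this.symm
    · exact ⟨0, fun h => absurd h hf⟩
  choose c hc using hspan
  -- The summand `1` only ensures that the constant is positive.
  refine ⟨1 + ∑ f, ∑ d, |c f d|, by positivity, fun v f hf => ?_⟩
  rw [hc f hf v, ← Finset.sum_coe_sort S.dice (fun d => |dieMean d v - S.avgMean v|),
    Finset.mul_sum]
  refine (Finset.abs_sum_le_sum_abs _ _).trans (Finset.sum_le_sum fun d _ => ?_)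
  rw [abs_mul]
  refine mul_le_mul_of_nonneg_right ?_ (abs_nonneg _)
  have h1 : |c f d| ≤ ∑ d, |c f d| :=
    Finset.single_le_sum (f := fun d => |c f d|) (fun _ _ => abs_nonneg _) (Finset.mem_univ d)
  have h2 : ∑ d, |c f d| ≤ ∑ f, ∑ d, |c f d| :=
    Finset.single_le_sum (f := fun f => ∑ d, |c f d|)
      (fun _ _ => Finset.sum_nonneg fun _ _ => abs_nonneg _) (Finset.mem_univ f)
  linarith

/-- If the positive variance condition fails, then there are a die `d₀` and a `κ > 0` such that
each payoff `v` that varies under `d₀` has another die beating the average by at least `κ` times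
the standard deviation under `d₀`. -/
theorem exists_profitable_die (h : ¬ S.NKPlus) : ∃ d₀ ∈ S.dice, ∃ κ > 0, ∀ v : F → ℝ,
    ∃ d ∈ S.dice, κ * √(dieVar d₀ v) ≤ dieMean d v - S.avgMean v := by
  obtain ⟨d₀, hd₀, hk⟩ := S.exists_kernel_le_vanishing h
  obtain ⟨C, hC, hdev⟩ := S.exists_deviation_bound hd₀ hk
  have hcard := S.card_dice_pos
  refine ⟨d₀, hd₀, (2 * S.dice.card * C)⁻¹, by positivity, fun v => ?_⟩
  obtain ⟨d, hd, hle⟩ := S.exists_deviation_le v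
  refine ⟨d, hd, le_trans ?_ hle⟩
  set D := ∑ e ∈ S.dice, |dieMean e v - S.avgMean v|
  have hD : 0 ≤ D := Finset.sum_nonneg fun _ _ => abs_nonneg _
  have hvar : dieVar d₀ v ≤ (C * D) ^ 2 := by
    rw [← dieMean_const (S.die_sum hd₀) ((C * D) ^ 2)]
    refine Finset.sum_le_sum fun f _ => ?_
    rcases (S.die_nonneg hd₀ f).eq_or_lt with h0 | hpos
    · simp [← h0]
    · exact mul_le_mul_of_nonneg_left (sq_le_sq' (abs_le.1 (hdev v f hpos)).1
        (abs_le.1 (hdev v f hpos)).2) hpos.le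
  have hsqrt : √(dieVar d₀ v) ≤ C * D := Real.sqrt_le_iff.2 ⟨by positivity, hvar⟩
  calc _ ≤ (2 * S.dice.card * C)⁻¹ * (C * D) := by gcongr
    _ = D / (2 * S.dice.card) := by field_simp

end GSVSource

/-! ### The lower bound on the number of samples -/

namespace GSVSource

variable {F : Type*} [Fintype F] (S : GSVSource F)

/-- The value of the payoff `e` with the given number of remaining samples, when the die `d₀` is
tossed except with probability equal to the conditional variance, in which case a uniformly
random die is tossed. -/
noncomputable def mixedValue (d₀ : F → ℝ) (e : List F → ℝ) : ℕ → List F → ℝ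
  | 0, l => e l
  | k + 1, l =>
    (1 - dieVar d₀ fun f => mixedValue d₀ e k (l ++ [f])) *
        dieMean d₀ (fun f => mixedValue d₀ e k (l ++ [f])) +
      (dieVar d₀ fun f => mixedValue d₀ e k (l ++ [f])) *
        S.avgMean fun f => mixedValue d₀ e k (l ++ [f])

theorem abs_mixedValue_le {d₀ : F → ℝ} (hd₀ : d₀ ∈ S.dice) {e : List F → ℝ}
    (he : ∀ l, |e l| ≤ 1) (k : ℕ) (l : List F) : |S.mixedValue d₀ e k l| ≤ 1 := by
  induction k generalizing l with
  | zero => exact he l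
  | succ k ih =>
    have hv : ∀ f, |S.mixedValue d₀ e k (l ++ [f])| ≤ 1 := fun f => ih _
    rw [mixedValue]
    set v := fun f => S.mixedValue d₀ e k (l ++ [f])
    have h0 := dieVar_nonneg (S.die_nonneg hd₀) v
    have h1 := dieVar_le_one (S.isDistribution d₀ hd₀) hv
    have h2 := abs_le.1 (abs_dieMean_le (S.isDistribution d₀ hd₀) hv)
    have h3 := abs_le.1 (S.abs_avgMean_le hv)
    rw [abs_le]
    constructor <;> nlinarith

/-- A convex combination of a die and the average is at most the best die. -/
theorem exists_mix_le {d₀ : F → ℝ} (hd₀ : d₀ ∈ S.dice) {s : ℝ} (h0 : 0 ≤ s) (h1 : s ≤ 1)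
    (v : F → ℝ) : ∃ d ∈ S.dice, (1 - s) * dieMean d₀ v + s * S.avgMean v ≤ dieMean d v := by
  obtain ⟨d, hd, h⟩ := S.exists_avgMean_le v
  rcases le_total (dieMean d₀ v) (dieMean d v) with hle | hle
  · exact ⟨d, hd, by nlinarith⟩
  · exact ⟨d₀, hd₀, by nlinarith⟩

/-- The mixed value is the payoff of a randomized strategy, so choosing at each step the worse
option of the mixture does no better. Technically this is the greedy choice for the negated value.
-/
theorem exists_mixedValue_le {d₀ : F → ℝ} (hd₀ : d₀ ∈ S.dice) {e : List F → ℝ}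
    (he : ∀ l, |e l| ≤ 1) (n : ℕ) :
    ∃ A, S.IsStrategy A ∧ stratExp A n e ≤ S.mixedValue d₀ e n [] := by
  obtain ⟨A, hA, h⟩ := S.exists_strategy_le (fun k l => -S.mixedValue d₀ e k l) (fun k l => by
    have hv : ∀ f, |S.mixedValue d₀ e k (l ++ [f])| ≤ 1 := fun f =>
      S.abs_mixedValue_le hd₀ he _ _
    rw [mixedValue]
    set v := fun f => S.mixedValue d₀ e k (l ++ [f])
    obtain ⟨d, hd, h⟩ := S.exists_mix_le hd₀ (dieVar_nonneg (S.die_nonneg hd₀) v)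
      (dieVar_le_one (S.isDistribution d₀ hd₀) hv) (fun f => -v f)
    refine ⟨d, hd, le_trans (le_of_eq ?_) h⟩
    rw [avgMean_neg]
    simp only [dieMean, mul_neg, Finset.sum_neg_distrib]
    ring) n
  refine ⟨A, hA, ?_⟩
  have hneg := stratExp_const_mul (A := A) n (-1) e
  simp only [mixedValue] at h
  simp only [neg_one_mul] at hneg
  rw [hneg] at h
  linarith

/-- One step of the adversary's gain: the mixed value, corrected by a concave term and a linear
loss, can be kept from decreasing. -/
theorem exists_corrected_mix_le {d₀ : F → ℝ} (hd₀ : d₀ ∈ S.dice) {κ τ c : ℝ} (hκ : 0 < κ)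
    (hτ : 0 < τ) {v : F → ℝ} (hv : ∀ f, |v f| ≤ 1)
    (hprofit : ∃ d ∈ S.dice, κ * √(dieVar d₀ v) ≤ dieMean d v - S.avgMean v) {V : ℝ}
    (hV : V = (1 - dieVar d₀ v) * dieMean d₀ v + dieVar d₀ v * S.avgMean v) :
    ∃ d ∈ S.dice, V + κ * τ / 6 * (1 - V ^ 2) - (c + κ * τ ^ 3 / 2) ≤
      ∑ f, d f * (v f + κ * τ / 6 * (1 - v f ^ 2) - c) := by
  obtain ⟨d, hd, hgain⟩ := hprofit
  have hexp : ∀ d ∈ S.dice, ∑ f, d f * (v f + κ * τ / 6 * (1 - v f ^ 2) - c) =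
      dieMean d v + κ * τ / 6 * (1 - dieMean d (fun f => v f ^ 2)) - c := by
    intro d hd
    have := dieMean_quadratic (S.die_sum hd) v (-(κ * τ / 6)) 1 (κ * τ / 6 - c)
    calc _ = dieMean d (fun f => -(κ * τ / 6) * v f ^ 2 + 1 * v f + (κ * τ / 6 - c)) :=
          Finset.sum_congr rfl fun f _ => by ring
      _ = _ := by rw [this]; ring
  set s := √(dieVar d₀ v) with hs
  have hs0 : 0 ≤ s := Real.sqrt_nonneg _
  have hvar0 := dieVar_nonneg (S.die_nonneg hd₀) v
  have hvar1 := dieVar_le_one (S.isDistribution d₀ hd₀) hv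
  have hs2 : dieVar d₀ v = s ^ 2 := (Real.sq_sqrt hvar0).symm
  rw [hs2] at hV hvar1
  have hm0 := abs_le.1 (abs_dieMean_le (S.isDistribution d₀ hd₀) hv)
  have hm := abs_le.1 (abs_dieMean_le (S.isDistribution d hd) hv)
  have hm' := abs_le.1 (S.abs_avgMean_le hv)
  have hq0 : dieMean d₀ (fun f => v f ^ 2) = s ^ 2 + dieMean d₀ v ^ 2 := by
    rw [← hs2, dieVar_eq (S.die_sum hd₀)]; ring
  -- Two values in `[-1, 1]` differ by at most `2`, so the second moment about `dieMean d₀ v` is at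
  -- most `4`.
  have hq : dieMean d (fun f => v f ^ 2) ≤
      4 + 2 * dieMean d₀ v * dieMean d v - dieMean d₀ v ^ 2 := by
    have h1 := dieMean_sq_sub (S.die_sum hd) v (dieMean d₀ v)
    have h2 : dieMean d (fun f => (v f - dieMean d₀ v) ^ 2) ≤ 4 := by
      rw [← dieMean_const (S.die_sum hd) 4]
      refine dieMean_mono (S.die_nonneg hd) fun f => ?_
      have := abs_le.1 (hv f)
      nlinarith
    linarith
  set a := dieMean d₀ v
  set b := dieMean d v
  set e := S.avgMean v
  set q₀ := dieMean d₀ (fun f => v f ^ 2)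
  set q := dieMean d (fun f => v f ^ 2)
  -- The right-hand side is what the mixture of `d₀` and `d` with weights `1 - s ^ 2` and `s ^ 2`
  -- achieves; one of the two dice does at least as well.
  have hmix : V + κ * τ / 6 * (1 - V ^ 2) - (c + κ * τ ^ 3 / 2) ≤
      (1 - s ^ 2) * (a + κ * τ / 6 * (1 - q₀) - c) +
        s ^ 2 * (b + κ * τ / 6 * (1 - q) - c) := by
    -- One step has quadratic variation `O(s ^ 2)`: `d₀` contributes its variance, and `d` is tossed
    -- only with probability `s ^ 2`.
    have hvariation : (1 - s ^ 2) * q₀ + s ^ 2 * q - V ^ 2 ≤ 9 * s ^ 2 := by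
      have h1 : s ^ 2 * q ≤ s ^ 2 * (4 + 2 * a * b - a ^ 2) :=
        mul_le_mul_of_nonneg_left hq (sq_nonneg s)
      have h2 : a * (b - e) ≤ 2 := by nlinarith
      have h3 : (1 - s ^ 2) * q₀ + s ^ 2 * (4 + 2 * a * b - a ^ 2) - V ^ 2 =
          s ^ 2 * (5 - s ^ 2) + 2 * s ^ 2 * (a * (b - e)) - (V - a) ^ 2 := by
        rw [hq0, hV]; ring
      nlinarith [sq_nonneg (V - a), mul_nonneg (sq_nonneg s) (sq_nonneg s),
        mul_le_mul_of_nonneg_left h2 (sq_nonneg s)]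
    have hg : κ * s ^ 3 ≤ s ^ 2 * (b - e) := by
      nlinarith [mul_le_mul_of_nonneg_left hgain (sq_nonneg s)]
    -- The product expands to `s ^ 3 - 3 / 2 * τ * s ^ 2 + τ ^ 3 / 2`: the gain, minus the variation
    -- cost `9 * s ^ 2` times `τ / 6`, plus the permitted loss. This fixes the constants `1 / 6` and
    -- `1 / 2`; `s = τ` is the critical case.
    have hcube : 0 ≤ κ * ((s - τ) ^ 2 * (s + τ / 2)) := by positivity
    have hvar := mul_le_mul_of_nonneg_left hvariation (show 0 ≤ κ * τ / 6 by positivity)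
    have hlin : (1 - s ^ 2) * a + s ^ 2 * b = V + s ^ 2 * (b - e) := by rw [hV]; ring
    nlinarith
  rcases le_total (a + κ * τ / 6 * (1 - q₀) - c) (b + κ * τ / 6 * (1 - q) - c) with hle | hle
  · refine ⟨d, hd, ?_⟩
    rw [hexp d hd]
    nlinarith
  · refine ⟨d₀, hd₀, ?_⟩
    rw [hexp d₀ hd₀]
    nlinarith [sq_nonneg s]

/-- Without the positive variance condition, extraction with error `ε` needs of the order of
`1 / ε ^ 2` samples. -/
theorem exists_sample_lower_bound (h : ¬ S.NKPlus) :
    ∃ c > 0, ∀ (ε : ℝ) (n : ℕ), 0 < ε → ε ≤ 1 / 10 → S.Extractable ε n → c < n * ε ^ 2 := by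
  obtain ⟨d₀, hd₀, κ, hκ, hprofit⟩ := S.exists_profitable_die h
  refine ⟨κ ^ 2 / 32768, by positivity, fun ε n hε hε2 ⟨Ext, hExt, hbound⟩ => ?_⟩
  by_contra! hn
  -- The payoff is extended to histories of every length, keeping the values `±1`.
  obtain ⟨e, he, heExt⟩ : ∃ e : List F → ℝ, (∀ l, e l = -1 ∨ e l = 1) ∧
      ∀ x : Fin n → F, e (List.ofFn x) = Ext x := by
    classical
    refine ⟨Function.extend List.ofFn Ext (fun _ => 1), fun l => ?_,
      fun x => List.ofFn_injective.extend_apply _ _ _⟩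
    by_cases hl : ∃ x : Fin n → F, List.ofFn x = l
    · obtain ⟨x, rfl⟩ := hl
      rw [List.ofFn_injective.extend_apply]
      exact hExt x
    · rw [Function.extend_apply' _ _ _ hl]
      exact Or.inr rfl
  have heabs : ∀ l, |e l| ≤ 1 := fun l => by rcases he l with h | h <;> simp [h]
  have hstrat : ∀ A, S.IsStrategy A → |stratExp A n e| ≤ ε := fun A hA => by
    simpa only [stratExp, heExt] using hbound A hA
  set V := S.mixedValue d₀ e
  have hVle : ∀ k l, |V k l| ≤ 1 := S.abs_mixedValue_le hd₀ heabs
  have hlow : -ε ≤ V n [] := by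
    obtain ⟨A, hA, hle⟩ := S.exists_mixedValue_le hd₀ heabs n
    exact (abs_le.1 (hstrat A hA)).1.trans hle
  -- With `κ * τ = 64 * ε`, the correction is worth `8 * ε` once `V ^ 2 ≤ 1 / 4`, while `n * ε ^ 2 ≤
  -- κ ^ 2 / 32768` keeps the total loss below or equal to `4 * ε`.
  obtain ⟨τ, hτ⟩ : ∃ τ, τ = 64 * ε / κ := ⟨_, rfl⟩
  have hτ0 : 0 < τ := by rw [hτ]; positivity
  obtain ⟨A, hA, hle⟩ := S.exists_strategy_le
    (fun k l => V k l + κ * τ / 6 * (1 - V k l ^ 2) - k * (κ * τ ^ 3 / 2)) (fun k l => by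
      have := S.exists_corrected_mix_le hd₀ (c := k * (κ * τ ^ 3 / 2)) hκ hτ0
        (v := fun f => V k (l ++ [f])) (fun f => hVle _ _) (hprofit _) (V := V (k + 1) l) rfl
      push_cast
      rw [add_mul, one_mul]
      exact this) n
  -- The correction vanishes at the end because the payoff is `±1`.
  have hfinal : (fun l => V 0 l + κ * τ / 6 * (1 - V 0 l ^ 2) - (0 : ℕ) * (κ * τ ^ 3 / 2)) = e := by
    funext l
    change e l + κ * τ / 6 * (1 - e l ^ 2) - (0 : ℕ) * (κ * τ ^ 3 / 2) = e l
    rcases he l with h | h <;> simp [h]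
  rw [hfinal] at hle
  have hup := hle.trans (abs_le.1 (hstrat A hA)).2
  have hκτ : κ * τ = 64 * ε := by rw [hτ]; field_simp
  have hnτ : n * τ ^ 2 ≤ 1 / 8 := by
    have : n * τ ^ 2 = n * ε ^ 2 * (4096 / κ ^ 2) := by rw [hτ]; ring
    rw [this]
    calc _ ≤ κ ^ 2 / 32768 * (4096 / κ ^ 2) := by gcongr
      _ = 1 / 8 := by field_simp; norm_num
  have hlin : n * (κ * τ ^ 3 / 2) ≤ 2 * (2 * ε) := by
    have : n * (κ * τ ^ 3 / 2) = (κ * τ) * (n * τ ^ 2) / 2 := by ring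
    rw [this, hκτ]
    nlinarith
  rw [hκτ] at hup
  have hV1 := abs_le.1 (hVle n [])
  have hV2 : 0 ≤ 64 * ε / 6 * (1 - V n [] ^ 2) := mul_nonneg (by positivity) (by nlinarith)
  -- Dropping the nonnegative correction gives `V ≤ 5 * ε`, and `V ≥ -ε`; so `V ^ 2 ≤ 1 / 4`. The
  -- full inequality then gives `V ≤ -3 * ε`, a contradiction.
  have hV3 : V n [] ≤ 1 / 2 := by linarith
  have hsq : V n [] ^ 2 ≤ 1 / 4 := by nlinarith
  nlinarith

theorem nkPlus_of_extractableSubquadratic (h : S.ExtractableSubquadratic) : S.NKPlus := by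
  by_contra hnk
  obtain ⟨c, hc, hlow⟩ := S.exists_sample_lower_bound hnk
  obtain ⟨N, hN, hlittle⟩ := h
  have h1 := hlittle.def hc
  have h2 : ∀ᶠ ε : ℝ in 𝓝[>] 0, ε ∈ Set.Ioo (0 : ℝ) (1 / 10) :=
    Ioo_mem_nhdsGT (by norm_num)
  obtain ⟨ε, hle, hε0, hε1⟩ := (h1.and h2).exists
  have h3 := hlow ε (N ε) hε0 hε1.le (hN ε hε0)
  rw [Real.norm_of_nonneg (by positivity), Real.norm_of_nonneg (by positivity)] at hle
  have : (N ε : ℝ) * ε ^ 2 ≤ c * (1 / ε ^ 2) * ε ^ 2 := by gcongr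
  rw [mul_assoc, one_div, inv_mul_cancel₀ (by positivity), mul_one] at this
  linarith

end GSVSource

/-! ### From logarithmic to subquadratic sample numbers -/

namespace GSVSource

variable {F : Type*} [Fintype F] (S : GSVSource F)

/-- The signs of the two outputs cancel under the uniform distribution, so the bias is at most the
`ℓ¹` distance from uniform, twice the total variation distance. -/
theorem extractable_of_isExtractor {ε : ℝ} {n : ℕ} {Ext : (Fin n → F) → (Fin 1 → Bool)}
    (h : S.IsExtractor ε Ext) : S.Extractable (2 * ε) n := by
  let sgn : (Fin 1 → Bool) → ℝ := fun y => if y 0 then 1 else -1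
  have hsgn : ∀ y, sgn y = -1 ∨ sgn y = 1 := fun y => by
    by_cases hy : y 0 <;> simp [sgn, hy]
  have hsum : ∑ y, sgn y = 0 := by
    rw [← (Equiv.funUnique (Fin 1) Bool).symm.sum_comp]
    simp [sgn]
  refine ⟨fun x => sgn (Ext x), fun x => hsgn _, fun A hA => ?_⟩
  have hfib : ∑ x, strategyProb A x * sgn (Ext x) = ∑ y, sgn y * outputProb Ext A y := by
    rw [← Finset.sum_fiberwise Finset.univ Ext]
    refine Finset.sum_congr rfl fun y _ => ?_
    rw [outputProb, Finset.mul_sum]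
    refine Finset.sum_congr rfl fun x hx => ?_
    rw [(Finset.mem_filter.1 hx).2, mul_comm]
  have hshift : ∑ y, sgn y * outputProb Ext A y =
      ∑ y, sgn y * (outputProb Ext A y - 1 / 2 ^ 1) := by
    simp only [mul_sub, Finset.sum_sub_distrib, ← Finset.sum_mul, hsum]
    ring
  rw [hfib, hshift]
  refine (Finset.abs_sum_le_sum_abs _ _).trans ?_
  have habs : ∀ y, |sgn y * (outputProb Ext A y - 1 / 2 ^ 1)| =
      |outputProb Ext A y - 1 / 2 ^ 1| := fun y => by
    rcases hsgn y with h | h <;> rw [h, abs_mul] <;> simp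
  simp only [habs]
  linarith [h A hA]

theorem Extractable.mono {ε ε' : ℝ} {n : ℕ} (h : S.Extractable ε n) (hε : ε ≤ ε') :
    S.Extractable ε' n := by
  obtain ⟨Ext, h1, h2⟩ := h
  exact ⟨Ext, h1, fun A hA => (h2 A hA).trans hε⟩

theorem extractableSubquadratic_of_logarithmic {c : ℕ} (h : S.ExtractableLogarithmic c) :
    S.ExtractableSubquadratic := by
  obtain ⟨p, C, K, h⟩ := h
  -- Half of `ε` compensates the factor `2`; the cap `1 / 2` provides an admissible error for large
  -- `ε`, where only existence matters.
  have hmin : ∀ ε : ℝ, 0 < ε → 0 < min (ε / 2) (1 / 2) ∧ min (ε / 2) (1 / 2) < 1 := fun ε hε =>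
    ⟨lt_min (by positivity) (by norm_num), (min_le_right _ _).trans_lt (by norm_num)⟩
  have hex : ∀ ε : ℝ, ∃ n : ℕ, 0 < ε → S.Extractable ε n ∧
      (n : ℝ) ≤ C * (Real.log (1 / min (ε / 2) (1 / 2)) + 1) := by
    intro ε
    by_cases hε : 0 < ε
    · obtain ⟨n, Ext, hn, hExt, -⟩ := h _ 1 (hmin ε hε).1 (hmin ε hε).2 le_rfl
      refine ⟨n, fun _ => ⟨(S.extractable_of_isExtractor hExt).mono S ?_, by simpa using hn⟩⟩
      linarith [min_le_left (ε / 2) (1 / 2)]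
    · exact ⟨0, fun h => absurd h hε⟩
  choose N hN using hex
  refine ⟨N, fun ε hε => (hN ε hε).1, isLittleO_iff.2 fun b hb => ?_⟩
  have hpos : 0 < min 1 (b / (3 * |C| + 1)) := lt_min one_pos (by positivity)
  filter_upwards [Ioo_mem_nhdsGT hpos] with ε hε
  obtain ⟨hε0, hε1⟩ := hε
  have hε2 : ε < 1 := hε1.trans_le (min_le_left _ _)
  have hε3 : ε * (3 * |C| + 1) < b :=
    (lt_div_iff₀ (by positivity)).1 (hε1.trans_le (min_le_right _ _))
  rw [Real.norm_of_nonneg (by positivity), Real.norm_of_nonneg (by positivity)]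
  have hle := (hN ε hε0).2
  rw [min_eq_left (by linarith)] at hle
  -- The crude bound `log x ≤ x - 1` already gives `O(1 / ε)` samples.
  have hlog : Real.log (1 / (ε / 2)) ≤ 2 / ε - 1 := by
    have := Real.log_le_sub_one_of_pos (x := 1 / (ε / 2)) (by positivity)
    rwa [one_div_div] at this ⊢
  have hlog0 : 0 ≤ Real.log (1 / (ε / 2)) := by
    refine Real.log_nonneg ?_
    rw [one_div_div, le_div_iff₀ hε0]; linarith
  calc (N ε : ℝ) ≤ C * (Real.log (1 / (ε / 2)) + 1) := hle
    _ ≤ |C| * (Real.log (1 / (ε / 2)) + 1) :=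
        mul_le_mul_of_nonneg_right (le_abs_self C) (by linarith)
    _ ≤ |C| * (2 / ε) := mul_le_mul_of_nonneg_left (by linarith) (abs_nonneg C)
    _ ≤ b * (1 / ε ^ 2) := by
        rw [mul_one_div, mul_div_assoc', div_le_div_iff₀ hε0 (by positivity)]
        nlinarith [abs_nonneg C]

end GSVSource

/-! ### Concentration of tilted martingales -/

/-- Quantitative concavity: the quadratic term turns variance of `u` into a strict decrease of the
expected square root. -/
theorem sqrt_one_add_le {u : ℝ} (h : |u| ≤ 1) : √(1 + u) ≤ 1 + u / 2 - u ^ 2 / 16 := by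
  obtain ⟨h1, h2⟩ := abs_le.1 h
  rw [Real.sqrt_le_iff]
  constructor
  · nlinarith
  · nlinarith [sq_nonneg u, sq_nonneg (u ^ 2), mul_nonneg (sq_nonneg u) (sub_nonneg.2 h2)]

/-- A distribution on `Y` that depends on the samples seen so far and evolves multiplicatively:
a sample `f` changes the mass of `y` by the factor `1 + tilt l y * ψ f`. The tilt is bounded away
from zero at all points except at one that carries most of the mass. -/
structure TiltedMartingale {F Y : Type*} [Fintype F] [Fintype Y] (ψ : F → ℝ) where
  mass : List F → Y → ℝ
  tilt : List F → Y → ℝ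
  mass_nonneg : ∀ l y, 0 ≤ mass l y
  mass_sum : ∀ l, ∑ y, mass l y = 1
  mass_nil : ∀ y, mass [] y = 1 / Fintype.card Y
  mass_append : ∀ l f y, mass (l ++ [f]) y = mass l y * (1 + tilt l y * ψ f)
  abs_tilt_le : ∀ l y, |tilt l y| ≤ 1
  le_abs_tilt : ∀ l y, 1 / 8 ≤ |tilt l y| ∨ 1 / 2 < mass l y

namespace TiltedMartingale

variable {F Y : Type*} [Fintype F] [Fintype Y] {ψ : F → ℝ} (M : TiltedMartingale (Y := Y) ψ)

theorem sum_mass_append {d : F → ℝ} (hd : d ∈ stdSimplex ℝ F) (h0 : dieMean d ψ = 0)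
    (l : List F) (y : Y) :
    ∑ f, d f * M.mass (l ++ [f]) y = M.mass l y := by
  have : ∀ f, d f * M.mass (l ++ [f]) y =
      M.mass l y * d f + M.mass l y * M.tilt l y * (d f * ψ f) := fun f => by
    rw [M.mass_append]; ring
  simp only [this, Finset.sum_add_distrib, ← Finset.mul_sum, hd.2]
  rw [← dieMean, h0]; ring

variable [Nonempty Y] [DecidableEq Y]

/-- The potential measuring how far the distribution is from being concentrated at one point. -/
noncomputable def potential (l : List F) : ℝ :=
  Finset.univ.inf' Finset.univ_nonempty fun y₀ => ∑ y ∈ Finset.univ.erase y₀, √(M.mass l y)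

/-- Omitting `y₀` is optimal exactly when its mass is largest, and any other point, having no more
mass than `y₀`, has at most half of the total. -/
theorem exists_potential_eq (l : List F) : ∃ y₀,
    M.potential l = ∑ y ∈ Finset.univ.erase y₀, √(M.mass l y) ∧
      ∀ y, y ≠ y₀ → M.mass l y ≤ 1 / 2 := by
  obtain ⟨y₀, -, h⟩ := Finset.exists_mem_eq_inf' (Finset.univ_nonempty (α := Y))
    fun y₀ => ∑ y ∈ Finset.univ.erase y₀, √(M.mass l y)
  refine ⟨y₀, h, fun y hy => ?_⟩
  have h1 : M.potential l ≤ ∑ z ∈ Finset.univ.erase y, √(M.mass l z) :=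
    Finset.inf'_le _ (Finset.mem_univ y)
  rw [potential, h] at h1
  have h2 := Finset.sum_erase_add Finset.univ (fun z => √(M.mass l z)) (Finset.mem_univ y)
  have h3 := Finset.sum_erase_add Finset.univ (fun z => √(M.mass l z)) (Finset.mem_univ y₀)
  have h4 : M.mass l y ≤ M.mass l y₀ :=
    (Real.sqrt_le_sqrt_iff (M.mass_nonneg l y₀)).1 (by linarith)
  have h5 : M.mass l y + M.mass l y₀ ≤ ∑ z, M.mass l z := by
    rw [← Finset.sum_pair hy]
    exact Finset.sum_le_univ_sum_of_nonneg (M.mass_nonneg l)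
  rw [M.mass_sum] at h5
  linarith

theorem potential_le (l : List F) (y₀ : Y) :
    M.potential l ≤ ∑ y ∈ Finset.univ.erase y₀, √(M.mass l y) :=
  Finset.inf'_le _ (Finset.mem_univ y₀)

theorem potential_nil_le : M.potential [] ≤ Fintype.card Y := by
  refine (M.potential_le [] (Classical.arbitrary Y)).trans ?_
  calc _ ≤ ∑ y ∈ Finset.univ.erase (Classical.arbitrary Y), (1 : ℝ) := by
        refine Finset.sum_le_sum fun y _ => ?_
        rw [M.mass_nil]
        refine Real.sqrt_le_iff.2 ⟨zero_le_one, ?_⟩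
        rw [one_pow, div_le_one (by exact_mod_cast Fintype.card_pos)]
        exact_mod_cast Fintype.card_pos
    _ ≤ ∑ y : Y, (1 : ℝ) := Finset.sum_le_univ_sum_of_nonneg fun _ => zero_le_one
    _ = _ := by simp

/-- Keep the omitted point `y₀` fixed during the step, which can only overestimate the new
potential. The other points have mass at most `1 / 2`, hence tilt at least `1 / 8`; the linear term
of the square root averages out and the quadratic one contributes `(1 / 16) * (1 / 64) * σ`. -/
theorem sum_potential_append_le {d : F → ℝ} (hd : d ∈ stdSimplex ℝ F)
    (h0 : dieMean d ψ = 0) (hψ : ∀ f, |ψ f| ≤ 1) {σ : ℝ} (hσ : σ ≤ dieVar d ψ) (l : List F) :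
    ∑ f, d f * M.potential (l ++ [f]) ≤ (1 - σ / 1024) * M.potential l := by
  obtain ⟨y₀, hpot, hsmall⟩ := M.exists_potential_eq l
  have hσ' : σ ≤ ∑ f, d f * ψ f ^ 2 := by
    rw [dieVar_eq hd.2, h0] at hσ
    simpa [dieMean] using hσ
  calc ∑ f, d f * M.potential (l ++ [f])
      ≤ ∑ f, d f * ∑ y ∈ Finset.univ.erase y₀, √(M.mass (l ++ [f]) y) :=
        Finset.sum_le_sum fun f _ => mul_le_mul_of_nonneg_left (M.potential_le _ y₀) (hd.1 f)
    _ = ∑ y ∈ Finset.univ.erase y₀, ∑ f, d f * √(M.mass (l ++ [f]) y) := by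
        simp only [Finset.mul_sum]
        exact Finset.sum_comm
    _ ≤ ∑ y ∈ Finset.univ.erase y₀, (1 - σ / 1024) * √(M.mass l y) := by
        refine Finset.sum_le_sum fun y hy => ?_
        have htilt : 1 / 8 ≤ |M.tilt l y| := (M.le_abs_tilt l y).resolve_right
          (not_lt.2 (hsmall y (Finset.ne_of_mem_erase hy)))
        have htilt2 : 1 / 64 ≤ M.tilt l y ^ 2 := by
          rw [← sq_abs]; nlinarith
        have hterm : ∀ f, d f * √(M.mass (l ++ [f]) y) ≤ √(M.mass l y) *
            (d f + M.tilt l y / 2 * (d f * ψ f) - M.tilt l y ^ 2 / 16 * (d f * ψ f ^ 2)) := by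
          intro f
          have habs : |M.tilt l y * ψ f| ≤ 1 := by
            rw [abs_mul]
            exact mul_le_one₀ (M.abs_tilt_le l y) (abs_nonneg _) (hψ f)
          rw [M.mass_append, Real.sqrt_mul (M.mass_nonneg l y)]
          have := mul_le_mul_of_nonneg_left (sqrt_one_add_le habs)
            (mul_nonneg (hd.1 f) (Real.sqrt_nonneg (M.mass l y)))
          linarith
        refine (Finset.sum_le_sum fun f _ => hterm f).trans ?_
        rw [← Finset.mul_sum, Finset.sum_sub_distrib, Finset.sum_add_distrib, ← Finset.mul_sum,
          ← Finset.mul_sum, hd.2, ← dieMean, h0, mul_comm (1 - σ / 1024)]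
        refine mul_le_mul_of_nonneg_left ?_ (Real.sqrt_nonneg _)
        have hs0 : 0 ≤ ∑ f, d f * ψ f ^ 2 :=
          Finset.sum_nonneg fun f _ => mul_nonneg (hd.1 f) (sq_nonneg _)
        nlinarith
    _ = _ := by rw [← Finset.mul_sum, hpot]

theorem one_sub_mass_le_potential (l : List F) : ∃ y₀, 1 - M.mass l y₀ ≤ M.potential l := by
  obtain ⟨y₀, hpot, -⟩ := M.exists_potential_eq l
  refine ⟨y₀, ?_⟩
  rw [hpot, ← M.mass_sum l, ← Finset.sum_erase_add Finset.univ _ (Finset.mem_univ y₀),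
    add_sub_cancel_right]
  refine Finset.sum_le_sum fun y hy => Real.le_sqrt_of_sq_le ?_
  have h1 : M.mass l y ≤ 1 := by
    rw [← M.mass_sum l]
    exact Finset.single_le_sum (fun z _ => M.mass_nonneg l z) (Finset.mem_univ y)
  nlinarith [M.mass_nonneg l y]

theorem sum_abs_indicator_sub_mass_le {l : List F} {z : Y}
    (hz : ∀ y, 1 / 2 < M.mass l y → z = y) :
    ∑ y, |(if z = y then 1 else 0) - M.mass l y| ≤ 4 * M.potential l := by
  obtain ⟨y₀, hy₀⟩ := M.one_sub_mass_le_potential l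
  have hle : ∀ y, M.mass l y ≤ 1 := fun y => by
    rw [← M.mass_sum l]
    exact Finset.single_le_sum (fun z _ => M.mass_nonneg l z) (Finset.mem_univ y)
  have hsum : ∑ y, |(if z = y then 1 else 0) - M.mass l y| = 2 * (1 - M.mass l z) := by
    have hs := M.mass_sum l
    rw [← Finset.sum_erase_add Finset.univ _ (Finset.mem_univ z)] at hs ⊢
    have : ∑ y ∈ Finset.univ.erase z, |(if z = y then 1 else 0) - M.mass l y| =
        ∑ y ∈ Finset.univ.erase z, M.mass l y := by
      refine Finset.sum_congr rfl fun y hy => ?_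
      rw [if_neg (Finset.ne_of_mem_erase hy).symm, zero_sub, abs_neg,
        abs_of_nonneg (M.mass_nonneg l y)]
    rw [this, if_pos rfl, abs_of_nonneg (by linarith [hle z])]
    linarith
  rw [hsum]
  -- Either `y₀` carries most of the mass and `z` is that point, or the potential is at least `1 /
  -- 2` and the bound exceeds the maximal distance `2`.
  by_cases h : 1 / 2 < M.mass l y₀
  · rw [hz y₀ h]
    linarith [hle y₀]
  · linarith [M.mass_nonneg l z]

/-- Reading off a point that carries most of the mass gives a nearly uniform output. -/
theorem output_error_le {A : List F → F → ℝ} (hA : ∀ l, A l ∈ stdSimplex ℝ F)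
    (h0 : ∀ l, dieMean (A l) ψ = 0) (hψ : ∀ f, |ψ f| ≤ 1) {σ : ℝ} (hσ1 : σ ≤ 1)
    (hσ : ∀ l, σ ≤ dieVar (A l) ψ) {out : List F → Y}
    (hout : ∀ l y, 1 / 2 < M.mass l y → out l = y) (n : ℕ) :
    (1 / 2 : ℝ) * ∑ y, |stratExp A n (fun l => if out l = y then 1 else 0) - 1 / Fintype.card Y| ≤
      2 * Fintype.card Y * (1 - σ / 1024) ^ n := by
  have hA0 : ∀ l f, 0 ≤ A l f := fun l => (hA l).1
  have hterm : ∀ y, |stratExp A n (fun l => if out l = y then 1 else 0) - 1 / Fintype.card Y| ≤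
      stratExp A n (fun l => |(if out l = y then 1 else 0) - M.mass l y|) := by
    intro y
    -- The uniform probability of `y` is its initial mass, hence its expected final mass.
    rw [← M.mass_nil y, ← stratExp_eq_of_martingale (A := A) (W := fun l => M.mass l y)
      (fun l => M.sum_mass_append (hA l) (h0 l) l y) n]
    simp only [stratExp, ← Finset.sum_sub_distrib, ← mul_sub]
    refine (Finset.abs_sum_le_sum_abs _ _).trans (le_of_eq ?_)
    refine Finset.sum_congr rfl fun x _ => ?_
    rw [abs_mul, abs_of_nonneg (strategyProb_nonneg hA0 x)]
  have hsum : ∑ y, stratExp A n (fun l => |(if out l = y then 1 else 0) - M.mass l y|) =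
      stratExp A n (fun l => ∑ y, |(if out l = y then 1 else 0) - M.mass l y|) := by
    simp only [stratExp, Finset.mul_sum]
    exact Finset.sum_comm
  have hpot := stratExp_le_of_contraction hA0 (show 0 ≤ 1 - σ / 1024 by linarith)
    (fun l => M.sum_potential_append_le (hA l) (h0 l) hψ (hσ l) l) n
  have hmono := stratExp_mono hA0 (n := n) fun l _ =>
    M.sum_abs_indicator_sub_mass_le (hout l)
  rw [stratExp_const_mul] at hmono
  have hnil := mul_le_mul_of_nonneg_left M.potential_nil_le
    (pow_nonneg (show 0 ≤ 1 - σ / 1024 by linarith) n)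
  have := (Finset.sum_le_sum fun y (_ : y ∈ Finset.univ) => hterm y).trans_eq hsum
  linarith

end TiltedMartingale

/-! ### A sparse representation of the distribution by dyadic intervals -/

/-- Finitely many pieces, each with its first element, its length and its mass. Entries with index
at least `count` are meaningless. -/
structure Pieces where
  count : ℕ
  start : ℕ → ℕ
  len : ℕ → ℕ
  mass : ℕ → ℝ

namespace Pieces

/-- The point `y` belongs to the `i`-th piece. -/
def Mem (D : Pieces) (i y : ℕ) : Prop := D.start i ≤ y ∧ y < D.start i + D.len i

/-- The pieces have lengths that are powers of two and partition `{0, …, 2 ^ m - 1}`, and their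
masses form a probability distribution. -/
structure Valid (m : ℕ) (D : Pieces) : Prop where
  len_eq : ∀ i < D.count, ∃ e, D.len i = 2 ^ e
  sum_len : ∑ i ∈ Finset.range D.count, D.len i = 2 ^ m
  end_le : ∀ i < D.count, D.start i + D.len i ≤ 2 ^ m
  mass_nonneg : ∀ i < D.count, 0 ≤ D.mass i
  sum_mass : ∑ i ∈ Finset.range D.count, D.mass i = 1
  cover : ∀ y < 2 ^ m, ∃ i < D.count, D.Mem i y
  disjoint : ∀ i < D.count, ∀ j < D.count, ∀ y, D.Mem i y → D.Mem j y → i = j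

/-- The index of the piece that contains `y`. -/
noncomputable def owner (D : Pieces) (y : ℕ) : ℕ := sInf {i | D.Mem i y}

/-- The mass of the point `y`, when the mass of each piece is spread uniformly. -/
noncomputable def density (D : Pieces) (y : ℕ) : ℝ := D.mass (D.owner y) / D.len (D.owner y)

/-- The total mass of the first `j` pieces. -/
noncomputable def prefixMass (D : Pieces) (j : ℕ) : ℝ := ∑ i ∈ Finset.range j, D.mass i

/-- The least number of initial pieces with total mass at least one half. -/
noncomputable def median (D : Pieces) : ℕ := sInf {j | 1 / 2 ≤ D.prefixMass j}

/-- The single piece `{0, …, 2 ^ m - 1}`. -/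
noncomputable def init (m : ℕ) : Pieces where
  count := 1
  start := fun _ => 0
  len := Function.update (fun _ => 0) 0 (2 ^ m)
  mass := Function.update (fun _ => 0) 0 1

/-- The `i`-th piece is cut into halves, the upper half becoming the last piece. -/
noncomputable def split (D : Pieces) (i : ℕ) : Pieces where
  count := D.count + 1
  start := Function.update D.start D.count (D.start i + D.len i / 2)
  len := Function.update (Function.update D.len i (D.len i / 2)) D.count (D.len i / 2)
  mass := Function.update (Function.update D.mass i (D.mass i / 2)) D.count (D.mass i / 2)

/-- The masses of the pieces with index from `lo` to `hi - 1` are multiplied with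
`1 + (1 - a) * v`, those of the others with `1 - a * v`. -/
noncomputable def reweight (D : Pieces) (lo hi : ℕ) (a v : ℝ) : Pieces :=
  { D with
    -- Entries beyond `count` stay untouched, so that this function equals the memory array
    -- everywhere.
    mass := fun q => if q < D.count then
        (if lo ≤ q ∧ q < hi then D.mass q * (1 + (1 - a) * v) else D.mass q * (1 - a * v))
      else D.mass q }

open Classical in
/-- The piece at which half of the mass is reached is split if it is too heavy. -/
noncomputable def refine (D : Pieces) : Pieces :=
  if 3 / 4 < D.prefixMass D.median ∧ D.len (D.median - 1) ≠ 1 then D.split (D.median - 1) else D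

open Classical in
/-- The index of the first of the selected pieces, of which `median - 1` is the last. -/
noncomputable def first (D : Pieces) : ℕ :=
  if 3 / 4 < D.prefixMass D.median then D.median - 1 else 0

open Classical in
/-- The total mass of the selected pieces. -/
noncomputable def weight (D : Pieces) : ℝ :=
  if 3 / 4 < D.prefixMass D.median then D.refine.mass (D.median - 1) else D.prefixMass D.median

/-- The update for a sample with payoff `v`. -/
noncomputable def step (D : Pieces) (v : ℝ) : Pieces :=
  D.refine.reweight D.first D.median D.weight v

open Classical in
/-- The relative change of the density at `y` in an update is `tilt y * v`. -/
noncomputable def tilt (D : Pieces) (y : ℕ) : ℝ :=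
  (if D.first ≤ D.refine.owner y ∧ D.refine.owner y < D.median then 1 else 0) - D.weight

namespace Valid

variable {m : ℕ} {D : Pieces} (hD : D.Valid m)
include hD

theorem owner_eq {i y : ℕ} (hi : i < D.count) (hy : D.Mem i y) : D.owner y = i := by
  have hmem : D.Mem (D.owner y) y := Nat.sInf_mem (s := {i | D.Mem i y}) ⟨i, hy⟩
  have hle : D.owner y ≤ i := Nat.sInf_le hy
  exact hD.disjoint _ (hle.trans_lt hi) _ hi y hmem hy

theorem owner_spec {y : ℕ} (hy : y < 2 ^ m) : D.owner y < D.count ∧ D.Mem (D.owner y) y := by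
  obtain ⟨i, hi, hm⟩ := hD.cover y hy
  rw [hD.owner_eq hi hm]
  exact ⟨hi, hm⟩

theorem density_eq {i y : ℕ} (hi : i < D.count) (hy : D.Mem i y) :
    D.density y = D.mass i / D.len i := by
  rw [density, hD.owner_eq hi hy]

theorem len_pos {i : ℕ} (hi : i < D.count) : 0 < D.len i := by
  obtain ⟨e, he⟩ := hD.len_eq i hi
  rw [he]; positivity

theorem count_le : D.count ≤ 2 ^ m := by
  rw [← hD.sum_len]
  calc D.count = ∑ i ∈ Finset.range D.count, 1 := by simp
    _ ≤ _ := Finset.sum_le_sum fun i hi => hD.len_pos (Finset.mem_range.1 hi)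

theorem density_nonneg {y : ℕ} (hy : y < 2 ^ m) : 0 ≤ D.density y :=
  div_nonneg (hD.mass_nonneg _ (hD.owner_spec hy).1) (Nat.cast_nonneg _)

theorem sum_density : ∑ y ∈ Finset.range (2 ^ m), D.density y = 1 := by
  rw [← Finset.sum_fiberwise_of_maps_to (g := D.owner) (t := Finset.range D.count)
    fun y hy => Finset.mem_range.2 (hD.owner_spec (Finset.mem_range.1 hy)).1, ← hD.sum_mass]
  refine Finset.sum_congr rfl fun i hi => ?_
  rw [Finset.mem_range] at hi
  have hset : (Finset.range (2 ^ m)).filter (fun y => D.owner y = i) =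
      Finset.Ico (D.start i) (D.start i + D.len i) := by
    ext y
    rw [Finset.mem_filter, Finset.mem_range, Finset.mem_Ico]
    constructor
    · rintro ⟨hy, rfl⟩
      exact (hD.owner_spec hy).2
    · intro hy
      exact ⟨hy.2.trans_le (hD.end_le i hi), hD.owner_eq hi hy⟩
  have hlen : (D.len i : ℝ) ≠ 0 := by exact_mod_cast (hD.len_pos hi).ne'
  calc _ = ∑ y ∈ (Finset.range (2 ^ m)).filter (fun y => D.owner y = i),
        D.mass i / D.len i :=
        Finset.sum_congr rfl fun y hy => by rw [density, (Finset.mem_filter.1 hy).2]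
    _ = D.mass i := by
        rw [hset, Finset.sum_const, Nat.card_Ico, Nat.add_sub_cancel_left, nsmul_eq_mul]
        field_simp

theorem mass_le_one {i : ℕ} (hi : i < D.count) : D.mass i ≤ 1 := by
  rw [← hD.sum_mass]
  exact Finset.single_le_sum (fun j hj => hD.mass_nonneg j (Finset.mem_range.1 hj))
    (Finset.mem_range.2 hi)

theorem prefixMass_mono {i j : ℕ} (hij : i ≤ j) (hj : j ≤ D.count) :
    D.prefixMass i ≤ D.prefixMass j :=
  Finset.sum_le_sum_of_subset_of_nonneg (Finset.range_mono hij)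
    fun k hk _ => hD.mass_nonneg k ((Finset.mem_range.1 hk).trans_le hj)

theorem half_le_prefixMass_median : 1 / 2 ≤ D.prefixMass D.median :=
  Nat.sInf_mem (s := {j | 1 / 2 ≤ D.prefixMass j})
    ⟨D.count, by
      change 1 / 2 ≤ D.prefixMass D.count
      rw [prefixMass, hD.sum_mass]; norm_num⟩

theorem median_le : D.median ≤ D.count :=
  Nat.sInf_le (by
    change 1 / 2 ≤ D.prefixMass D.count
    rw [prefixMass, hD.sum_mass]; norm_num)

omit hD in
theorem _root_.Pieces.prefixMass_lt_of_lt_median {j : ℕ} (hj : j < D.median) :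
    D.prefixMass j < 1 / 2 :=
  not_le.1 (Nat.notMem_of_lt_sInf hj)

theorem median_pos : 0 < D.median := by
  refine Nat.pos_of_ne_zero fun h => ?_
  have := hD.half_le_prefixMass_median
  rw [h] at this
  norm_num [prefixMass] at this

theorem prefixMass_median : D.prefixMass D.median =
    D.prefixMass (D.median - 1) + D.mass (D.median - 1) := by
  have := hD.median_pos
  conv_lhs => rw [show D.median = D.median - 1 + 1 by omega]
  rw [prefixMass, Finset.sum_range_succ, prefixMass]

theorem prefixMass_median_pred_lt : D.prefixMass (D.median - 1) < 1 / 2 :=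
  prefixMass_lt_of_lt_median (by have := hD.median_pos; omega)

theorem median_pred_lt : D.median - 1 < D.count := by
  have := hD.median_pos
  have := hD.median_le
  omega

theorem split {i : ℕ} (hi : i < D.count) (hlen : D.len i ≠ 1) : (D.split i).Valid m := by
  obtain ⟨e, he⟩ := hD.len_eq i hi
  -- A power of two other than `1` is even, so that the halving is exact.
  obtain ⟨e, rfl⟩ : ∃ e', e = e' + 1 := Nat.exists_eq_succ_of_ne_zero fun h => hlen (by simp [he, h])
  have hhalf : D.len i / 2 = 2 ^ e := by rw [he, pow_succ]; simp
  have hlast : ∀ j < D.count, j ≠ D.count := fun j hj => hj.ne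
  have hlen_lt : ∀ j < D.count, (D.split i).len j = if j = i then 2 ^ e else D.len j := by
    intro j hj
    simp [Pieces.split, Function.update_apply, hlast j hj, hhalf]
  have hlen_last : (D.split i).len D.count = 2 ^ e := by simp [Pieces.split, hhalf]
  have hstart_lt : ∀ j < D.count, (D.split i).start j = D.start j := by
    intro j hj
    simp [Pieces.split, hlast j hj]
  have hstart_last : (D.split i).start D.count = D.start i + 2 ^ e := by
    simp [Pieces.split, hhalf]
  have hmass_lt : ∀ j < D.count, (D.split i).mass j = if j = i then D.mass i / 2 else D.mass j := by
    intro j hj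
    simp [Pieces.split, Function.update_apply, hlast j hj]
  have hmass_last : (D.split i).mass D.count = D.mass i / 2 := by simp [Pieces.split]
  have hcount : (D.split i).count = D.count + 1 := rfl
  have hend := hD.end_le i hi
  have he2 : D.len i = 2 ^ e + 2 ^ e := by rw [he, pow_succ]; ring
  have hmem_lt : ∀ j < D.count, ∀ y, (D.split i).Mem j y → D.Mem j y := by
    intro j hj y hy
    unfold Mem at hy ⊢
    rw [hstart_lt j hj, hlen_lt j hj] at hy
    split_ifs at hy with h
    · subst h; omega
    · exact hy
  have hmem_last : ∀ y, (D.split i).Mem D.count y →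
      D.Mem i y ∧ ¬ (D.split i).Mem i y := by
    intro y hy
    unfold Mem at hy ⊢
    rw [hstart_last, hlen_last] at hy
    rw [hstart_lt i hi, hlen_lt i hi, if_pos rfl]
    omega
  constructor
  · intro j hj
    rcases Nat.lt_succ_iff_lt_or_eq.1 hj with h | rfl
    · rw [hlen_lt j h]
      split_ifs
      · exact ⟨e, rfl⟩
      · exact hD.len_eq j h
    · exact ⟨e, hlen_last⟩
  · rw [hcount, Finset.sum_range_succ, hlen_last, ← hD.sum_len,
      ← Finset.add_sum_erase _ _ (Finset.mem_range.2 hi),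
      ← Finset.add_sum_erase _ (fun j => D.len j) (Finset.mem_range.2 hi), hlen_lt i hi, if_pos rfl,
      he2]
    have : ∑ j ∈ (Finset.range D.count).erase i, (D.split i).len j =
        ∑ j ∈ (Finset.range D.count).erase i, D.len j :=
      Finset.sum_congr rfl fun j hj => by
        rw [hlen_lt j (Finset.mem_range.1 (Finset.mem_of_mem_erase hj)),
          if_neg (Finset.ne_of_mem_erase hj)]
    rw [this]; ring
  · intro j hj
    rcases Nat.lt_succ_iff_lt_or_eq.1 hj with h | rfl
    · rw [hlen_lt j h, hstart_lt j h]
      have := hD.end_le j h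
      split_ifs with hji
      · subst hji; omega
      · exact this
    · rw [hlen_last, hstart_last]; omega
  · intro j hj
    rcases Nat.lt_succ_iff_lt_or_eq.1 hj with h | rfl
    · rw [hmass_lt j h]
      split_ifs
      · exact div_nonneg (hD.mass_nonneg i hi) zero_le_two
      · exact hD.mass_nonneg j h
    · rw [hmass_last]
      exact div_nonneg (hD.mass_nonneg i hi) zero_le_two
  · rw [hcount, Finset.sum_range_succ, hmass_last, ← hD.sum_mass,
      ← Finset.add_sum_erase _ _ (Finset.mem_range.2 hi),
      ← Finset.add_sum_erase _ (fun j => D.mass j) (Finset.mem_range.2 hi), hmass_lt i hi,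
      if_pos rfl]
    have : ∑ j ∈ (Finset.range D.count).erase i, (D.split i).mass j =
        ∑ j ∈ (Finset.range D.count).erase i, D.mass j :=
      Finset.sum_congr rfl fun j hj => by
        rw [hmass_lt j (Finset.mem_range.1 (Finset.mem_of_mem_erase hj)),
          if_neg (Finset.ne_of_mem_erase hj)]
    rw [this]; ring
  · intro y hy
    obtain ⟨j, hj, hm⟩ := hD.cover y hy
    by_cases hji : j = i
    · subst hji
      unfold Mem at hm
      by_cases hlow : y < D.start j + 2 ^ e
      · refine ⟨j, by omega, ?_⟩
        unfold Mem
        rw [hstart_lt j hj, hlen_lt j hj, if_pos rfl]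
        omega
      · refine ⟨D.count, by omega, ?_⟩
        unfold Mem
        rw [hstart_last, hlen_last]
        omega
    · refine ⟨j, by omega, ?_⟩
      unfold Mem at hm ⊢
      rwa [hstart_lt j hj, hlen_lt j hj, if_neg hji]
  · intro j hj k hk y hjy hky
    rcases Nat.lt_succ_iff_lt_or_eq.1 hj with h | rfl <;>
      rcases Nat.lt_succ_iff_lt_or_eq.1 hk with h' | rfl
    · exact hD.disjoint j h k h' y (hmem_lt j h y hjy) (hmem_lt k h' y hky)
    · obtain ⟨h1, h2⟩ := hmem_last y hky
      have := hD.disjoint j h i hi y (hmem_lt j h y hjy) h1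
      subst this
      exact absurd hjy h2
    · obtain ⟨h1, h2⟩ := hmem_last y hjy
      have := hD.disjoint k h' i hi y (hmem_lt k h' y hky) h1
      subst this
      exact absurd hky h2
    · rfl

theorem density_split {i y : ℕ} (hi : i < D.count) (hlen : D.len i ≠ 1) (hy : y < 2 ^ m) :
    (D.split i).density y = D.density y := by
  have hS := hD.split hi hlen
  obtain ⟨j, hj, hm⟩ := hS.cover y hy
  rw [hS.density_eq hj hm]
  obtain ⟨e, he⟩ := hD.len_eq i hi
  obtain ⟨e, rfl⟩ : ∃ e', e = e' + 1 := Nat.exists_eq_succ_of_ne_zero fun h => hlen (by simp [he, h])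
  have hhalf : D.len i / 2 = 2 ^ e := by rw [he, pow_succ]; simp
  have he2 : D.len i = 2 ^ e + 2 ^ e := by rw [he, pow_succ]; ring
  have hdens : D.mass i / 2 / ((2 ^ e : ℕ) : ℝ) = D.mass i / D.len i := by
    rw [he2]; push_cast; field_simp; ring
  rcases Nat.lt_succ_iff_lt_or_eq.1 hj with h | rfl
  · by_cases hji : j = i
    · subst hji
      have hm' : D.Mem j y := by
        simp only [Mem, Pieces.split, Function.update_self, Function.update_of_ne h.ne, hhalf] at hm
        unfold Mem
        omega
      rw [hD.density_eq h hm', ← hdens]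
      simp [Pieces.split, Function.update_of_ne h.ne, hhalf]
    · have hm' : D.Mem j y := by
        simpa [Mem, Pieces.split, Function.update_of_ne h.ne, Function.update_of_ne hji] using hm
      rw [hD.density_eq h hm']
      simp [Pieces.split, Function.update_of_ne h.ne, Function.update_of_ne hji]
  · have hm' : D.Mem i y := by
      simp only [Mem, Pieces.split, Function.update_self, hhalf] at hm
      unfold Mem
      omega
    rw [hD.density_eq hi hm', ← hdens]
    simp [Pieces.split, hhalf]

/-- The factors are nonnegative since `a` and `|v|` are at most `1`. The total is preserved because
`a * (1 - a) = (1 - a) * a`: what the selected pieces gain the others lose. -/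
theorem reweight {lo hi : ℕ} {a v : ℝ} (hhi : hi ≤ D.count)
    (ha : a = ∑ i ∈ Finset.Ico lo hi, D.mass i) (hv : |v| ≤ 1) :
    (D.reweight lo hi a v).Valid m := by
  obtain ⟨hv1, hv2⟩ := abs_le.1 hv
  have hsub : Finset.Ico lo hi ⊆ Finset.range D.count := fun i hi => by
    rw [Finset.mem_Ico] at hi
    exact Finset.mem_range.2 (by omega)
  have ha0 : 0 ≤ a := ha ▸ Finset.sum_nonneg fun i hi =>
    hD.mass_nonneg i (Finset.mem_range.1 (hsub hi))
  have ha1 : a ≤ 1 := by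
    rw [ha, ← hD.sum_mass]
    exact Finset.sum_le_sum_of_subset_of_nonneg hsub
      fun i hi _ => hD.mass_nonneg i (Finset.mem_range.1 hi)
  refine ⟨hD.len_eq, hD.sum_len, hD.end_le, fun i hi => ?_, ?_, hD.cover, hD.disjoint⟩
  · change i < D.count at hi
    have := hD.mass_nonneg i hi
    simp only [Pieces.reweight, if_pos hi]
    split_ifs <;> apply mul_nonneg this <;> nlinarith
  · have hterm : ∀ i ∈ Finset.range D.count, (D.reweight lo hi a v).mass i =
        D.mass i * (1 - a * v) + v * if i ∈ Finset.Ico lo hi then D.mass i else 0 := by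
      intro i hi
      simp only [Pieces.reweight, if_pos (Finset.mem_range.1 hi), Finset.mem_Ico]
      split_ifs <;> ring
    rw [show (D.reweight lo hi a v).count = D.count from rfl, Finset.sum_congr rfl hterm,
      Finset.sum_add_distrib, ← Finset.sum_mul, ← Finset.mul_sum, Finset.sum_ite_mem,
      Finset.inter_eq_right.2 hsub, ← ha, hD.sum_mass]
    ring

omit hD in
theorem _root_.Pieces.owner_reweight (lo hi : ℕ) (a v : ℝ) (y : ℕ) :
    (D.reweight lo hi a v).owner y = D.owner y := rfl

open Classical in
theorem density_reweight (lo hi : ℕ) (a v : ℝ) {y : ℕ} (hy : y < 2 ^ m) :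
    (D.reweight lo hi a v).density y = D.density y *
      (1 + ((if lo ≤ D.owner y ∧ D.owner y < hi then 1 else 0) - a) * v) := by
  rw [density, density, owner_reweight]
  simp only [Pieces.reweight, if_pos (hD.owner_spec hy).1]
  split_ifs <;> ring

theorem refine : D.refine.Valid m := by
  unfold Pieces.refine
  split_ifs with h
  · exact hD.split hD.median_pred_lt h.2
  · exact hD

theorem density_refine {y : ℕ} (hy : y < 2 ^ m) : D.refine.density y = D.density y := by
  unfold Pieces.refine
  split_ifs with h
  · exact hD.density_split hD.median_pred_lt h.2 hy
  · rfl

omit hD in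
theorem _root_.Pieces.count_le_count_refine : D.count ≤ D.refine.count := by
  unfold Pieces.refine
  split_ifs
  · exact Nat.le_succ _
  · exact le_rfl

omit hD in
theorem _root_.Pieces.count_refine_le : D.refine.count ≤ D.count + 1 := by
  unfold Pieces.refine
  split_ifs
  · exact le_rfl
  · exact Nat.le_succ _

/-- Splitting keeps the lower half at index `median - 1` and appends the upper half, so the selected
set is still a range of indices. -/
theorem weight_eq : D.weight = ∑ i ∈ Finset.Ico D.first D.median, D.refine.mass i := by
  unfold weight first
  split_ifs with h
  · have hIco : Finset.Ico (D.median - 1) D.median = {D.median - 1} := by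
      have := hD.median_pos
      ext i
      rw [Finset.mem_Ico, Finset.mem_singleton]
      omega
    rw [hIco, Finset.sum_singleton]
  · rw [Pieces.refine, if_neg fun h' => h h'.1, ← Finset.range_eq_Ico, prefixMass]

theorem step {v : ℝ} (hv : |v| ≤ 1) : (D.step v).Valid m :=
  hD.refine.reweight (hD.median_le.trans count_le_count_refine) hD.weight_eq hv

theorem density_step (v : ℝ) {y : ℕ} (hy : y < 2 ^ m) :
    (D.step v).density y = D.density y * (1 + D.tilt y * v) := by
  rw [Pieces.step, hD.refine.density_reweight _ _ _ _ hy, hD.density_refine hy, tilt]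

theorem mass_median_pred_gt (h : 3 / 4 < D.prefixMass D.median) :
    1 / 4 < D.mass (D.median - 1) := by
  have h1 := hD.prefixMass_median
  have h2 := hD.prefixMass_median_pred_lt
  linarith

/-- When the prefix up to the median is heavier than `3 / 4`, its last piece has mass above `1 / 4`,
since the rest is below `1 / 2`; halving leaves more than `1 / 8`. -/
theorem weight_mem : D.weight ∈ Set.Icc (1 / 8 : ℝ) 1 := by
  unfold weight
  split_ifs with h
  · have h1 := hD.mass_median_pred_gt h
    have h2 := hD.mass_le_one hD.median_pred_lt
    unfold Pieces.refine
    split_ifs with h'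
    · simp only [Pieces.split, Function.update_self, Function.update_of_ne hD.median_pred_lt.ne]
      constructor <;> linarith
    · constructor <;> linarith
  · have := hD.half_le_prefixMass_median
    constructor <;> linarith

theorem abs_tilt_le (y : ℕ) : |D.tilt y| ≤ 1 := by
  obtain ⟨h1, h2⟩ := hD.weight_mem
  unfold tilt
  rw [abs_le]
  split_ifs <;> constructor <;> linarith

/-- Unselected points have tilt `-weight`, selected ones `1 - weight`. The latter is small only if
`weight > 3 / 4`; then the selection is a piece that could not be split, that is, a single heavy
point. -/
theorem le_abs_tilt (y : ℕ) : 1 / 8 ≤ |D.tilt y| ∨ 1 / 2 < D.density y := by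
  obtain ⟨h1, h2⟩ := hD.weight_mem
  by_cases hw : D.weight ≤ 3 / 4
  · left
    unfold tilt
    rw [le_abs]
    split_ifs
    · left; linarith
    · right; linarith
  · by_cases hsel : D.first ≤ D.refine.owner y ∧ D.refine.owner y < D.median
    · right
      have hbig : 3 / 4 < D.prefixMass D.median := by
        by_contra hb
        rw [weight, if_neg hb] at hw
        exact hb (not_le.1 hw)
      have howner : D.refine.owner y = D.median - 1 := by
        rw [first, if_pos hbig] at hsel
        omega
      have hlen : D.len (D.median - 1) = 1 := by
        by_contra hl
        rw [weight, if_pos hbig, Pieces.refine, if_pos ⟨hbig, hl⟩] at hw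
        simp only [Pieces.split, Function.update_self,
          Function.update_of_ne hD.median_pred_lt.ne] at hw
        linarith [hD.mass_le_one hD.median_pred_lt]
      have href : D.refine = D := by rw [Pieces.refine, if_neg fun h => h.2 hlen]
      rw [weight, if_pos hbig, href] at hw
      rw [href] at howner
      rw [density, howner, hlen, Nat.cast_one, div_one]
      linarith
    · left
      rw [tilt, if_neg hsel, zero_sub, abs_neg, le_abs]
      left; exact h1

theorem start_median_pred_lt : D.start (D.median - 1) < 2 ^ m := by
  have h1 := hD.end_le _ hD.median_pred_lt
  have h2 := hD.len_pos hD.median_pred_lt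
  omega

/-- Mass at most `1` and density above `1 / 2` force length `1`. The pieces before this one have
mass below `1 / 2`, so the median is reached exactly there. This lets the output be read off without
searching for the heaviest point. -/
theorem start_median_pred_eq {y : ℕ} (hy : y < 2 ^ m) (h : 1 / 2 < D.density y) :
    D.start (D.median - 1) = y := by
  obtain ⟨hi, hm⟩ := hD.owner_spec hy
  rw [density] at h
  set i := D.owner y
  have hpos := hD.len_pos hi
  have hmass := hD.mass_le_one hi
  have hpos' : (0 : ℝ) < D.len i := by exact_mod_cast hpos
  rw [lt_div_iff₀ hpos'] at h
  have hlen : D.len i = 1 := by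
    have : (D.len i : ℝ) < 2 := by linarith
    have : D.len i < 2 := by exact_mod_cast this
    omega
  rw [hlen, Nat.cast_one, mul_one] at h
  have hsucc : D.prefixMass (i + 1) = D.prefixMass i + D.mass i := by
    rw [prefixMass, Finset.sum_range_succ, prefixMass]
  have h0 : 0 ≤ D.prefixMass i := Finset.sum_nonneg fun j hj =>
    hD.mass_nonneg j ((Finset.mem_range.1 hj).trans hi)
  have h1 : D.prefixMass (i + 1) ≤ 1 := by
    rw [← hD.sum_mass]
    exact hD.prefixMass_mono (j := D.count) hi le_rfl
  have h2 : D.median ≤ i + 1 := Nat.sInf_le (by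
    change 1 / 2 ≤ D.prefixMass (i + 1)
    linarith)
  have h3 : i < D.median := by
    by_contra hc
    have := hD.prefixMass_mono (not_lt.1 hc) hi.le
    linarith [hD.half_le_prefixMass_median]
  rw [show D.median - 1 = i by omega]
  unfold Mem at hm
  omega

end Valid

theorem valid_init (m : ℕ) : (init m).Valid m := by
  constructor
  · intro i hi
    obtain rfl : i = 0 := Nat.lt_one_iff.1 hi
    exact ⟨m, by simp [init]⟩
  · simp [init]
  · intro i hi
    obtain rfl : i = 0 := Nat.lt_one_iff.1 hi
    simp [init]
  · intro i hi
    obtain rfl : i = 0 := Nat.lt_one_iff.1 hi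
    simp [init]
  · simp [init]
  · intro y hy
    exact ⟨0, Nat.one_pos, by simpa [Mem, init] using hy⟩
  · intro i hi j hj _ _ _
    exact (Nat.lt_one_iff.1 hi).trans (Nat.lt_one_iff.1 hj).symm

theorem density_init {m y : ℕ} (hy : y < 2 ^ m) : (init m).density y = 1 / 2 ^ m := by
  rw [(valid_init m).density_eq (i := 0) Nat.one_pos (by simpa [Mem, init] using hy)]
  simp [init]

/-- The state after samples with the payoffs `l`. -/
noncomputable def run (m : ℕ) (l : List ℝ) : Pieces := l.foldl step (init m)

theorem run_append (m : ℕ) (l : List ℝ) (v : ℝ) : run m (l ++ [v]) = (run m l).step v := by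
  simp [run]

theorem valid_run (m : ℕ) {l : List ℝ} (hl : ∀ v ∈ l, |v| ≤ 1) : (run m l).Valid m := by
  induction l using List.reverseRecOn with
  | nil => exact valid_init m
  | append_singleton l v ih =>
    rw [run_append]
    exact (ih fun w hw => hl w (by simp [hw])).step (hl v (by simp))

/-- This is what makes the running time polynomial in `n` independently of `2 ^ m`. -/
theorem count_run_le (m : ℕ) (l : List ℝ) : (run m l).count ≤ l.length + 1 := by
  induction l using List.reverseRecOn with
  | nil => exact le_rfl
  | append_singleton l v ih =>
    rw [run_append, List.length_append, List.length_singleton]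
    exact count_refine_le.trans (Nat.succ_le_succ ih)

/-- The evolution of the pieces as a martingale of distributions. -/
noncomputable def martingale {F : Type*} [Fintype F] {ψ : F → ℝ} (hψ : ∀ f, |ψ f| ≤ 1) (m : ℕ) :
    TiltedMartingale (Y := Fin (2 ^ m)) ψ :=
  have hvalid : ∀ l : List F, (run m (l.map ψ)).Valid m := fun l =>
    valid_run m fun v hv => by
      obtain ⟨f, -, rfl⟩ := List.mem_map.1 hv
      exact hψ f
  { mass := fun l y => (run m (l.map ψ)).density y
    tilt := fun l y => (run m (l.map ψ)).tilt y
    mass_nonneg := fun l y => (hvalid l).density_nonneg y.2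
    mass_sum := fun l => by
      rw [Fin.sum_univ_eq_sum_range fun y => (run m (l.map ψ)).density y]
      exact (hvalid l).sum_density
    mass_nil := fun y => by
      have := density_init y.2
      simpa [run] using this
    mass_append := fun l f y => by
      rw [List.map_append, List.map_singleton, run_append, (hvalid l).density_step _ y.2]
    abs_tilt_le := fun l y => (hvalid l).abs_tilt_le y
    le_abs_tilt := fun l y => (hvalid l).le_abs_tilt y }

end Pieces

/-! ### Running time calculus for programs -/

namespace RealRAM

/-- The program `p` leads from `s` to `s'` in at most `T` steps. -/
def Runs (p : Program) (s : State) (T : ℕ) (s' : State) : Prop := ∃ t ≤ T, Exec p s t s'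

namespace Runs

variable {p q : Program} {s s' s'' : State} {T T' : ℕ}

theorem mono (h : Runs p s T s') (hT : T ≤ T') : Runs p s T' s' := by
  obtain ⟨t, ht, hp⟩ := h
  exact ⟨t, ht.trans hT, hp⟩

theorem seq (hp : Runs p s T s') (hq : Runs q s' T' s'') : Runs (.seq p q) s (T + T') s'' := by
  obtain ⟨t, ht, hp⟩ := hp
  obtain ⟨t', ht', hq⟩ := hq
  exact ⟨_, Nat.add_le_add ht ht', hp.seq hq⟩

theorem skip (s : State) : Runs .skip s 1 s := ⟨1, le_rfl, .skip s⟩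

theorem condTrue {b : Cond} (hb : b.Holds s) (hp : Runs p s T s') :
    Runs (.cond b p q) s (b.cost + T + 1) s' := by
  obtain ⟨t, ht, hp⟩ := hp
  exact ⟨_, by omega, .condTrue hb hp⟩

theorem condFalse {b : Cond} (hb : ¬ b.Holds s) (hq : Runs q s T s') :
    Runs (.cond b p q) s (b.cost + T + 1) s' := by
  obtain ⟨t, ht, hq⟩ := hq
  exact ⟨_, by omega, .condFalse hb hq⟩

theorem of_eq {s₀ s₁ : State} (h : Runs p s T s') (hs : s = s₀) (hT : T ≤ T') (hs' : s' = s₁) :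
    Runs p s₀ T' s₁ := by
  subst hs hs'
  exact h.mono hT

/-- A loop with an invariant that is executed `N` times. -/
theorem loop_of_invariant {b : Cond} (I : ℕ → State → Prop) {N : ℕ}
    (hb : ∀ i < N, ∀ s, I i s → b.Holds s) (hN : ∀ s, I N s → ¬ b.Holds s)
    (hp : ∀ i < N, ∀ s, I i s → ∃ s', Runs p s T s' ∧ I (i + 1) s') (hs : I 0 s) :
    ∃ s', Runs (.loop b p) s (N * (T + b.cost + 1) + (b.cost + 1)) s' ∧ I N s' := by
  have key : ∀ j ≤ N, ∀ s, I (N - j) s →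
      ∃ s', Runs (.loop b p) s (j * (T + b.cost + 1) + (b.cost + 1)) s' ∧ I N s' := by
    intro j
    induction j with
    | zero =>
      intro _ s hs
      exact ⟨s, ⟨_, by omega, .loopFalse (hN s hs)⟩, hs⟩
    | succ j ih =>
      intro hj s hs
      obtain ⟨s', ⟨t, ht, hexec⟩, hs'⟩ := hp (N - (j + 1)) (by omega) s hs
      rw [show N - (j + 1) + 1 = N - j by omega] at hs'
      obtain ⟨s'', ⟨t', ht', hexec'⟩, hs''⟩ := ih (by omega) s' hs'
      refine ⟨s'', ⟨_, ?_, .loopTrue (hb _ (by omega) s hs) hexec hexec'⟩, hs''⟩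
      rw [Nat.succ_mul]
      omega
  exact key N le_rfl s (by simpa using hs)

/-- A loop with explicitly known intermediate states. -/
theorem loop_of_states {b : Cond} (σ : ℕ → State) {N : ℕ} (hb : ∀ i < N, b.Holds (σ i))
    (hN : ¬ b.Holds (σ N)) (hp : ∀ i < N, Runs p (σ i) T (σ (i + 1))) :
    Runs (.loop b p) (σ 0) (N * (T + b.cost + 1) + (b.cost + 1)) (σ N) := by
  obtain ⟨s', h, rfl⟩ := loop_of_invariant (p := p) (T := T) (fun i s => s = σ i)
    (fun i hi s hs => hs ▸ hb i hi) (fun s hs => hs ▸ hN)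
    (fun i hi s hs => ⟨_, hs ▸ hp i hi, rfl⟩) rfl
  exact h

end Runs

/-! ### Memory layout of the extraction program -/

/-- The named variables and arrays of the extraction program. -/
structure Regs where
  n : ℕ
  m : ℕ
  count : ℕ
  hi : ℕ
  lo : ℕ
  time : ℕ
  idx : ℕ
  code : ℕ
  acc : ℝ
  val : ℝ
  sample : ℕ → ℕ
  out : ℕ → ℕ
  start : ℕ → ℕ
  len : ℕ → ℕ
  table : ℕ → ℝ
  mass : ℕ → ℝ

namespace Regs

/-- The memory holding the named variables and arrays. -/
def toState (r : Regs) : State where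
  natVar
    | 0 => r.n
    | 1 => r.m
    | 2 => r.count
    | 3 => r.hi
    | 4 => r.lo
    | 5 => r.time
    | 6 => r.idx
    | 7 => r.code
    | _ => 0
  natArr
    | 0 => r.sample
    | 1 => r.out
    | 2 => r.start
    | 3 => r.len
    | _ => fun _ => 0
  realVar
    | 0 => r.acc
    | 1 => r.val
    | _ => 0
  realArr
    | 0 => r.table
    | 1 => r.mass
    | _ => fun _ => 0

variable (r : Regs)

/-- This and the analogous statements below turn assignments into record updates, so that programs
are analysed on `Regs` instead of raw memory. -/
theorem runs_count (e : NatExpr) : Runs (.setNat 2 e) r.toState (e.cost + 1)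
    { r with count := e.eval r.toState }.toState := by
  refine Runs.of_eq ⟨_, le_rfl, Exec.setNat r.toState 2 e⟩ rfl le_rfl ?_
  simp only [toState, State.setNat, State.mk.injEq, and_true]
  funext x
  rcases x with _ | _ | _ | _ | _ | _ | _ | _ | x <;> simp

theorem runs_hi (e : NatExpr) : Runs (.setNat 3 e) r.toState (e.cost + 1)
    { r with hi := e.eval r.toState }.toState := by
  refine Runs.of_eq ⟨_, le_rfl, Exec.setNat r.toState 3 e⟩ rfl le_rfl ?_
  simp only [toState, State.setNat, State.mk.injEq, and_true]
  funext x
  rcases x with _ | _ | _ | _ | _ | _ | _ | _ | x <;> simp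

theorem runs_lo (e : NatExpr) : Runs (.setNat 4 e) r.toState (e.cost + 1)
    { r with lo := e.eval r.toState }.toState := by
  refine Runs.of_eq ⟨_, le_rfl, Exec.setNat r.toState 4 e⟩ rfl le_rfl ?_
  simp only [toState, State.setNat, State.mk.injEq, and_true]
  funext x
  rcases x with _ | _ | _ | _ | _ | _ | _ | _ | x <;> simp

theorem runs_time (e : NatExpr) : Runs (.setNat 5 e) r.toState (e.cost + 1)
    { r with time := e.eval r.toState }.toState := by
  refine Runs.of_eq ⟨_, le_rfl, Exec.setNat r.toState 5 e⟩ rfl le_rfl ?_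
  simp only [toState, State.setNat, State.mk.injEq, and_true]
  funext x
  rcases x with _ | _ | _ | _ | _ | _ | _ | _ | x <;> simp

theorem runs_idx (e : NatExpr) : Runs (.setNat 6 e) r.toState (e.cost + 1)
    { r with idx := e.eval r.toState }.toState := by
  refine Runs.of_eq ⟨_, le_rfl, Exec.setNat r.toState 6 e⟩ rfl le_rfl ?_
  simp only [toState, State.setNat, State.mk.injEq, and_true]
  funext x
  rcases x with _ | _ | _ | _ | _ | _ | _ | _ | x <;> simp

theorem runs_code (e : NatExpr) : Runs (.setNat 7 e) r.toState (e.cost + 1)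
    { r with code := e.eval r.toState }.toState := by
  refine Runs.of_eq ⟨_, le_rfl, Exec.setNat r.toState 7 e⟩ rfl le_rfl ?_
  simp only [toState, State.setNat, State.mk.injEq, and_true]
  funext x
  rcases x with _ | _ | _ | _ | _ | _ | _ | _ | x <;> simp

theorem runs_acc (e : RealExpr) : Runs (.setReal 0 e) r.toState (e.cost + 1)
    { r with acc := e.eval r.toState }.toState := by
  refine Runs.of_eq ⟨_, le_rfl, Exec.setReal r.toState 0 e⟩ rfl le_rfl ?_
  simp only [toState, State.setReal, State.mk.injEq, and_true, true_and]
  funext x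
  rcases x with _ | _ | x <;> simp

theorem runs_val (e : RealExpr) : Runs (.setReal 1 e) r.toState (e.cost + 1)
    { r with val := e.eval r.toState }.toState := by
  refine Runs.of_eq ⟨_, le_rfl, Exec.setReal r.toState 1 e⟩ rfl le_rfl ?_
  simp only [toState, State.setReal, State.mk.injEq, and_true, true_and]
  funext x
  rcases x with _ | _ | x <;> simp

theorem runs_out (i e : NatExpr) : Runs (.setNatArr 1 i e) r.toState (i.cost + e.cost + 1)
    { r with out := Function.update r.out (i.eval r.toState) (e.eval r.toState) }.toState := by
  refine Runs.of_eq ⟨_, le_rfl, Exec.setNatArr r.toState 1 i e⟩ rfl le_rfl ?_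
  simp only [toState, State.setNatArr, State.mk.injEq, and_true, true_and]
  funext x
  rcases x with _ | _ | _ | _ | x <;> simp

theorem runs_start (i e : NatExpr) : Runs (.setNatArr 2 i e) r.toState (i.cost + e.cost + 1)
    { r with start := Function.update r.start (i.eval r.toState) (e.eval r.toState) }.toState := by
  refine Runs.of_eq ⟨_, le_rfl, Exec.setNatArr r.toState 2 i e⟩ rfl le_rfl ?_
  simp only [toState, State.setNatArr, State.mk.injEq, and_true, true_and]
  funext x
  rcases x with _ | _ | _ | _ | x <;> simp

theorem runs_len (i e : NatExpr) : Runs (.setNatArr 3 i e) r.toState (i.cost + e.cost + 1)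
    { r with len := Function.update r.len (i.eval r.toState) (e.eval r.toState) }.toState := by
  refine Runs.of_eq ⟨_, le_rfl, Exec.setNatArr r.toState 3 i e⟩ rfl le_rfl ?_
  simp only [toState, State.setNatArr, State.mk.injEq, and_true, true_and]
  funext x
  rcases x with _ | _ | _ | _ | x <;> simp

theorem runs_table (i : NatExpr) (e : RealExpr) :
    Runs (.setRealArr 0 i e) r.toState (i.cost + e.cost + 1)
      { r with table := Function.update r.table (i.eval r.toState) (e.eval r.toState) }.toState := by
  refine Runs.of_eq ⟨_, le_rfl, Exec.setRealArr r.toState 0 i e⟩ rfl le_rfl ?_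
  simp only [toState, State.setRealArr, State.mk.injEq, true_and]
  funext x
  rcases x with _ | _ | x <;> simp

theorem runs_mass (i : NatExpr) (e : RealExpr) :
    Runs (.setRealArr 1 i e) r.toState (i.cost + e.cost + 1)
      { r with mass := Function.update r.mass (i.eval r.toState) (e.eval r.toState) }.toState := by
  refine Runs.of_eq ⟨_, le_rfl, Exec.setRealArr r.toState 1 i e⟩ rfl le_rfl ?_
  simp only [toState, State.setRealArr, State.mk.injEq, true_and]
  funext x
  rcases x with _ | _ | x <;> simp

/-- The registers with the pieces `D` stored in them. -/
def load (r : Regs) (D : Pieces) : Regs :=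
  { r with count := D.count, start := D.start, len := D.len, mass := D.mass }

end Regs

/-! ### The building blocks of the program -/

/-- Stores the first `N` values of `g` in the table. -/
def tableProgram (g : ℕ → ℝ) : ℕ → Program
  | 0 => .skip
  | N + 1 => .seq (tableProgram g N) (.setRealArr 0 (.const N) (.const (g N)))

theorem runs_tableProgram (r : Regs) (g : ℕ → ℝ) (N : ℕ) :
    Runs (tableProgram g N) r.toState (3 * N + 1)
      { r with table := fun i => if i < N then g i else r.table i }.toState := by
  induction N with
  | zero => simpa [tableProgram] using Runs.skip r.toState
  | succ N ih =>
    refine (ih.seq (Regs.runs_table _ (.const N) (.const (g N)))).of_eq rfl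
      (by simp only [NatExpr.cost, RealExpr.cost]; omega) ?_
    refine congrArg (fun f => { r with table := f : Regs }.toState) ?_
    funext i
    simp only [NatExpr.eval, RealExpr.eval, Function.update_apply]
    split_ifs <;> first | omega | simp_all

/-- Initializes the pieces. -/
noncomputable def initProgram : Program :=
  .seq (.setNat 2 (.const 1)) <|
  .seq (.setNatArr 3 (.const 0) (.const 1)) <|
  .seq (.setRealArr 1 (.const 0) (.const 1)) <|
  .seq (.setNat 6 (.const 0)) <|
  .loop (.natLt (.var 6) (.var 1)) <|
    .seq (.setNatArr 3 (.const 0) (.add (.get 3 (.const 0)) (.get 3 (.const 0))))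
      (.setNat 6 (.add (.var 6) (.const 1)))

theorem runs_initProgram (r : Regs) (hstart : r.start = fun _ => 0) (hlen : r.len = fun _ => 0)
    (hmass : r.mass = fun _ => 0) :
    Runs initProgram r.toState (15 * r.m + 14)
      ({ r with idx := r.m }.load (Pieces.init r.m)).toState := by
  -- The length `2 ^ m` is produced by `m` doublings, there being no multiplication of integers.
  let σ : ℕ → Regs := fun i => { r with
    count := 1, idx := i, len := Function.update (fun _ => 0) 0 (2 ^ i),
    mass := Function.update (fun _ => 0) 0 1 }
  have hloop : Runs (.loop (.natLt (.var 6) (.var 1)) <|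
      .seq (.setNatArr 3 (.const 0) (.add (.get 3 (.const 0)) (.get 3 (.const 0))))
        (.setNat 6 (.add (.var 6) (.const 1)))) (σ 0).toState
      (r.m * (11 + 3 + 1) + (3 + 1)) (σ r.m).toState := by
    refine Runs.loop_of_states (fun i => (σ i).toState) (fun i hi => hi)
      (fun h => lt_irrefl _ h) fun i _ => ?_
    refine ((Regs.runs_len (σ i) _ _).seq (Regs.runs_idx _ _)).of_eq rfl
      (by simp [NatExpr.cost]) (congrArg Regs.toState ?_)
    simp [σ, NatExpr.eval, Regs.toState, pow_succ, mul_two]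
  have hσ : σ r.m = { r with idx := r.m }.load (Pieces.init r.m) := by
    simp [σ, Regs.load, Pieces.init, hstart]
  rw [← hσ]
  refine ((Regs.runs_count r _).seq ((Regs.runs_len _ _ _).seq ((Regs.runs_mass _ _ _).seq
    ((Regs.runs_idx _ _).seq (?_ : Runs _ _ (r.m * (11 + 3 + 1) + (3 + 1)) _))))).mono ?_
  · refine hloop.of_eq (congrArg Regs.toState ?_) le_rfl rfl
    simp [σ, hlen, hmass, NatExpr.eval, RealExpr.eval]
  · simp only [NatExpr.cost, RealExpr.cost]
    omega

/-- Computes the least number of initial pieces with at least half of the mass. -/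
noncomputable def medianProgram : Program :=
  .seq (.setNat 3 (.const 0)) <|
  .seq (.setReal 0 (.const 0)) <|
  .loop (.realLt (.var 0) (.const (1 / 2))) <|
    .seq (.setReal 0 (.add (.var 0) (.get 1 (.var 3)))) (.setNat 3 (.add (.var 3) (.const 1)))

theorem runs_medianProgram {m : ℕ} {D : Pieces} (hD : D.Valid m) (r : Regs) :
    Runs medianProgram (r.load D).toState (13 * D.count + 8)
      ({ r with hi := D.median, acc := D.prefixMass D.median }.load D).toState := by
  -- The loop reaches the median within `D.count` rounds, because the total mass is `1`.
  let σ : ℕ → Regs := fun i => { r with hi := i, acc := D.prefixMass i }.load D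
  have hloop : Runs (.loop (.realLt (.var 0) (.const (1 / 2))) <|
      .seq (.setReal 0 (.add (.var 0) (.get 1 (.var 3)))) (.setNat 3 (.add (.var 3) (.const 1))))
      (σ 0).toState (D.median * (9 + 3 + 1) + (3 + 1)) (σ D.median).toState := by
    refine Runs.loop_of_states (fun i => (σ i).toState)
      (fun i hi => Pieces.prefixMass_lt_of_lt_median hi)
      (fun h => (not_lt.2 hD.half_le_prefixMass_median) h) fun i _ => ?_
    refine ((Regs.runs_acc (σ i) _).seq (Regs.runs_hi _ _)).of_eq rfl
      (by simp [NatExpr.cost, RealExpr.cost]) (congrArg Regs.toState ?_)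
    simp [σ, Regs.load, NatExpr.eval, RealExpr.eval, Regs.toState, Pieces.prefixMass,
      Finset.sum_range_succ]
  refine ((Regs.runs_hi _ _).seq ((Regs.runs_acc _ _).seq
    (?_ : Runs _ _ (D.median * (9 + 3 + 1) + (3 + 1)) (σ D.median).toState))).mono ?_
  · refine hloop.of_eq (congrArg Regs.toState ?_) le_rfl rfl
    simp [σ, Regs.load, NatExpr.eval, RealExpr.eval, Pieces.prefixMass]
  · have := hD.median_le
    simp only [NatExpr.cost, RealExpr.cost]
    omega

/-- Splits the piece whose index is stored in the variable `lo`. -/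
noncomputable def splitProgram : Program :=
  .seq (.setNatArr 3 (.var 4) (.half (.get 3 (.var 4)))) <|
  .seq (.setNatArr 3 (.var 2) (.get 3 (.var 4))) <|
  .seq (.setNatArr 2 (.var 2) (.add (.get 2 (.var 4)) (.get 3 (.var 4)))) <|
  .seq (.setRealArr 1 (.var 4) (.div (.get 1 (.var 4)) (.const 2))) <|
  .seq (.setRealArr 1 (.var 2) (.get 1 (.var 4)))
    (.setNat 2 (.add (.var 2) (.const 1)))

theorem runs_splitProgram {D : Pieces} (r : Regs) (h : r.lo < D.count) :
    Runs splitProgram (r.load D).toState 30 (r.load (D.split r.lo)).toState := by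
  refine ((Regs.runs_len (r.load D) _ _).seq ((Regs.runs_len _ _ _).seq
    ((Regs.runs_start _ _ _).seq ((Regs.runs_mass _ _ _).seq ((Regs.runs_mass _ _ _).seq
    (Regs.runs_count _ _)))))).of_eq rfl ?_ (congrArg Regs.toState ?_)
  rotate_left
  · simp [Regs.load, Pieces.split, NatExpr.eval, RealExpr.eval, Regs.toState,
      Function.update_of_ne h.ne]
  · simp [NatExpr.cost, RealExpr.cost]

/-- Splits the piece at which half of the mass is reached if it is too heavy, and computes the
first of the selected pieces and their total mass. -/
noncomputable def refineProgram : Program :=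
  .cond (.realLt (.const (3 / 4)) (.var 0))
    (.seq (.setNat 4 (.sub (.var 3) (.const 1))) <|
      .seq (.cond (.natEq (.get 3 (.var 4)) (.const 1)) .skip splitProgram)
        (.setReal 0 (.get 1 (.var 4))))
    (.setNat 4 (.const 0))

theorem runs_refineProgram {m : ℕ} {D : Pieces} (hD : D.Valid m) (r : Regs)
    (hhi : r.hi = D.median) (hacc : r.acc = D.prefixMass D.median) :
    Runs refineProgram (r.load D).toState 50
      ({ r with lo := D.first, acc := D.weight }.load D.refine).toState := by
  by_cases h : 3 / 4 < D.prefixMass D.median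
  · have hb : (Cond.realLt (.const (3 / 4)) (.var 0)).Holds (r.load D).toState := by
      change 3 / 4 < r.acc
      rwa [hacc]
    let r' : Regs := { r with lo := D.median - 1 }
    have hfirst : Runs (.setNat 4 (.sub (.var 3) (.const 1))) (r.load D).toState 4
        (r'.load D).toState := by
      refine (Regs.runs_lo (r.load D) _).of_eq rfl
        (by simp [NatExpr.cost]) (congrArg Regs.toState ?_)
      simp [r', Regs.load, NatExpr.eval, Regs.toState, hhi]
    have hsplit : Runs (.cond (.natEq (.get 3 (.var 4)) (.const 1)) .skip splitProgram)
        (r'.load D).toState 35 (r'.load D.refine).toState := by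
      by_cases hl : D.len (D.median - 1) = 1
      · have : D.refine = D := by rw [Pieces.refine, if_neg fun h => h.2 hl]
        rw [this]
        have hb : (Cond.natEq (.get 3 (.var 4)) (.const 1)).Holds (r'.load D).toState := hl
        exact (Runs.condTrue hb (Runs.skip _)).mono (by simp [Cond.cost, NatExpr.cost])
      · have : D.refine = D.split (D.median - 1) := by rw [Pieces.refine, if_pos ⟨h, hl⟩]
        rw [this]
        have hb : ¬ (Cond.natEq (.get 3 (.var 4)) (.const 1)).Holds (r'.load D).toState := hl
        exact (Runs.condFalse hb (runs_splitProgram r' hD.median_pred_lt)).mono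
          (by simp [Cond.cost, NatExpr.cost])
    have hacc' : Runs (.setReal 0 (.get 1 (.var 4))) (r'.load D.refine).toState 3
        ({ r with lo := D.first, acc := D.weight }.load D.refine).toState := by
      refine (Regs.runs_acc (r'.load D.refine) _).of_eq rfl
        (by simp [NatExpr.cost, RealExpr.cost]) (congrArg Regs.toState ?_)
      simp [r', Regs.load, RealExpr.eval, NatExpr.eval, Regs.toState, Pieces.first, Pieces.weight, h]
    exact (Runs.condTrue hb (hfirst.seq (hsplit.seq hacc'))).mono
      (by simp [Cond.cost, RealExpr.cost])
  · have hb : ¬ (Cond.realLt (.const (3 / 4)) (.var 0)).Holds (r.load D).toState := by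
      change ¬ 3 / 4 < r.acc
      rwa [hacc]
    have hrefine : D.refine = D := by rw [Pieces.refine, if_neg fun h' => h h'.1]
    have hlo : Runs (.setNat 4 (.const 0)) (r.load D).toState 2
        ({ r with lo := D.first, acc := D.weight }.load D.refine).toState := by
      refine (Regs.runs_lo (r.load D) _).of_eq rfl
        (by simp [NatExpr.cost]) (congrArg Regs.toState ?_)
      simp [Regs.load, NatExpr.eval, Pieces.first, Pieces.weight, h, hrefine, hacc]
    exact (Runs.condFalse hb hlo).mono (by simp [Cond.cost, RealExpr.cost])

/-- Updates the masses of the pieces. -/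
noncomputable def reweightProgram : Program :=
  .seq (.setNat 6 (.const 0)) <|
  .loop (.natLt (.var 6) (.var 2)) <|
    .seq
      (.cond (.conj (.neg (.natLt (.var 6) (.var 4))) (.natLt (.var 6) (.var 3)))
        (.setRealArr 1 (.var 6)
          (.mul (.get 1 (.var 6)) (.add (.const 1) (.mul (.sub (.const 1) (.var 0)) (.var 1)))))
        (.setRealArr 1 (.var 6)
          (.mul (.get 1 (.var 6)) (.sub (.const 1) (.mul (.var 0) (.var 1))))))
      (.setNat 6 (.add (.var 6) (.const 1)))

theorem runs_reweightProgram (D : Pieces) (r : Regs) :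
    Runs reweightProgram (r.load D).toState (29 * D.count + 6)
      ({ r with idx := D.count }.load (D.reweight r.lo r.hi r.acc r.val)).toState := by
  let w : ℕ → ℝ := fun x => if r.lo ≤ x ∧ x < r.hi then D.mass x * (1 + (1 - r.acc) * r.val)
    else D.mass x * (1 - r.acc * r.val)
  -- The mass array after `i` rounds: the first `i` entries are updated, the later ones are still
  -- old.
  let μ : ℕ → ℕ → ℝ := fun i x => if x < i then w x else D.mass x
  let σ : ℕ → Regs := fun i => { (r.load D) with idx := i, mass := μ i }
  have hμ : ∀ i, μ (i + 1) = Function.update (μ i) i (w i) := by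
    intro i
    funext x
    simp only [μ, Function.update_apply]
    split_ifs <;> first | omega | simp_all
  have hμi : ∀ i, μ i i = D.mass i := fun i => by simp [μ]
  have hbody : ∀ i, Runs (.cond (.conj (.neg (.natLt (.var 6) (.var 4))) (.natLt (.var 6) (.var 3)))
      (.setRealArr 1 (.var 6)
        (.mul (.get 1 (.var 6)) (.add (.const 1) (.mul (.sub (.const 1) (.var 0)) (.var 1)))))
      (.setRealArr 1 (.var 6)
        (.mul (.get 1 (.var 6)) (.sub (.const 1) (.mul (.var 0) (.var 1))))))
      (σ i).toState 21 { (σ i) with mass := μ (i + 1) }.toState := by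
    intro i
    by_cases h : r.lo ≤ i ∧ i < r.hi
    · have hb : (Cond.conj (.neg (.natLt (.var 6) (.var 4))) (.natLt (.var 6) (.var 3))).Holds
          (σ i).toState := ⟨not_lt.2 h.1, h.2⟩
      refine (Runs.condTrue (T := 12) hb ?_).mono
        (by simp [Cond.cost, NatExpr.cost])
      refine (Regs.runs_mass (σ i) _ _).of_eq rfl
        (by simp [NatExpr.cost, RealExpr.cost]) (congrArg Regs.toState ?_)
      rw [hμ]
      simp [σ, w, h, hμi, Regs.load, NatExpr.eval, RealExpr.eval, Regs.toState]
    · have hb : ¬ (Cond.conj (.neg (.natLt (.var 6) (.var 4))) (.natLt (.var 6) (.var 3))).Holds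
          (σ i).toState := fun h' => h ⟨not_lt.1 h'.1, h'.2⟩
      refine (Runs.condFalse (T := 10) hb ?_).mono
        (by simp [Cond.cost, NatExpr.cost])
      refine (Regs.runs_mass (σ i) _ _).of_eq rfl
        (by simp [NatExpr.cost, RealExpr.cost]) (congrArg Regs.toState ?_)
      rw [hμ]
      simp [σ, w, h, hμi, Regs.load, NatExpr.eval, RealExpr.eval, Regs.toState]
  have hloop := Runs.loop_of_states (b := .natLt (.var 6) (.var 2)) (N := D.count)
    (fun i => (σ i).toState) (fun i hi => hi) (fun h => lt_irrefl _ h)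
    fun i _ => (hbody i).seq (Regs.runs_idx _ (.add (.var 6) (.const 1)))
  have hσ : σ D.count =
      { r with idx := D.count }.load (D.reweight r.lo r.hi r.acc r.val) := by
    simp [σ, μ, w, Regs.load, Pieces.reweight]
  rw [← hσ]
  refine ((Regs.runs_idx _ _).seq (T' := D.count * (25 + 3 + 1) + (3 + 1)) ?_).mono ?_
  · refine hloop.of_eq (congrArg Regs.toState ?_) le_rfl rfl
    simp [σ, μ, Regs.load, NatExpr.eval]
  · simp only [NatExpr.cost]
    omega

/-- Processes one sample. -/
noncomputable def stepProgram : Program :=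
  .seq medianProgram <|
  .seq refineProgram <|
  .seq (.setReal 1 (.get 0 (.get 0 (.var 5)))) <|
  .seq reweightProgram
    (.setNat 5 (.add (.var 5) (.const 1)))

theorem runs_stepProgram {m : ℕ} {D : Pieces} (hD : D.Valid m) (r : Regs) :
    Runs stepProgram (r.load D).toState (42 * D.count + 101)
      ({ r with
        hi := D.median, lo := D.first, acc := D.weight, val := r.table (r.sample r.time),
        idx := D.refine.count, time := r.time + 1 }.load
          (D.step (r.table (r.sample r.time)))).toState := by
  have h1 := runs_medianProgram hD r
  have h2 := runs_refineProgram hD { r with hi := D.median, acc := D.prefixMass D.median } rfl rfl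
  have h3 := Regs.runs_val ({ r with hi := D.median, lo := D.first, acc := D.weight }.load D.refine)
    (.get 0 (.get 0 (.var 5)))
  have h4 := runs_reweightProgram D.refine { r with
    hi := D.median, lo := D.first, acc := D.weight, val := r.table (r.sample r.time) }
  have h5 := Regs.runs_time ({ r with
    hi := D.median, lo := D.first, acc := D.weight, val := r.table (r.sample r.time),
    idx := D.refine.count }.load (D.step (r.table (r.sample r.time)))) (.add (.var 5) (.const 1))
  refine (h1.seq (h2.seq (h3.seq (h4.seq h5)))).mono ?_
  have := D.count_refine_le
  simp only [NatExpr.cost, RealExpr.cost]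
  omega

/-- Outputs the first element of the piece at which half of the mass is reached, in binary. -/
noncomputable def outputProgram : Program :=
  .seq medianProgram <|
  .seq (.setNat 7 (.get 2 (.sub (.var 3) (.const 1)))) <|
  .seq (.setNat 6 (.const 0)) <|
  .loop (.natLt (.var 6) (.var 1)) <|
    .seq (.setNatArr 1 (.var 6) (.sub (.var 7) (.add (.half (.var 7)) (.half (.var 7))))) <|
    .seq (.setNat 7 (.half (.var 7)))
      (.setNat 6 (.add (.var 6) (.const 1)))

theorem exists_runs_outputProgram {m : ℕ} {D : Pieces} (hD : D.Valid m) (r : Regs) :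
    ∃ s, Runs outputProgram (r.load D).toState (13 * D.count + 20 * r.m + 30) s ∧
      ∀ i < r.m, s.natArr 1 i = ((D.start (D.median - 1)).testBit i).toNat := by
  set z := D.start (D.median - 1)
  let r' : Regs := { r with hi := D.median, acc := D.prefixMass D.median }
  -- The `x`-th bit is `z / 2 ^ x % 2`, computed as `w - (w / 2 + w / 2)` with `w = z / 2 ^ x`.
  let out : ℕ → ℕ → ℕ := fun i x => if x < i then z / 2 ^ x % 2 else r.out x
  let σ : ℕ → Regs := fun i => { (r'.load D) with idx := i, code := z / 2 ^ i, out := out i }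
  have hout : ∀ i, out (i + 1) = Function.update (out i) i
      (z / 2 ^ i - (z / 2 ^ i / 2 + z / 2 ^ i / 2)) := by
    intro i
    funext x
    simp only [out, Function.update_apply]
    by_cases hx : x = i
    · subst hx
      rw [if_pos (Nat.lt_succ_self x), if_pos rfl]
      omega
    · rw [if_neg hx]
      split_ifs <;> omega
  have hloop : Runs (.loop (.natLt (.var 6) (.var 1)) <|
      .seq (.setNatArr 1 (.var 6) (.sub (.var 7) (.add (.half (.var 7)) (.half (.var 7))))) <|
      .seq (.setNat 7 (.half (.var 7))) (.setNat 6 (.add (.var 6) (.const 1))))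
      (σ 0).toState (r.m * (16 + 3 + 1) + (3 + 1)) (σ r.m).toState := by
    refine Runs.loop_of_states (fun i => (σ i).toState) (fun i hi => hi)
      (fun h => lt_irrefl _ h) fun i _ => ?_
    refine ((Regs.runs_out (σ i) _ _).seq ((Regs.runs_code _ _).seq (Regs.runs_idx _ _))).of_eq rfl
      (by simp [NatExpr.cost]) (congrArg Regs.toState ?_)
    simp [σ, hout, NatExpr.eval, Regs.toState, pow_succ, Nat.div_div_eq_div_mul]
  refine ⟨(σ r.m).toState, ?_, fun i hi => ?_⟩
  · refine ((runs_medianProgram hD r).seq ((Regs.runs_code _ _).seq ((Regs.runs_idx _ _).seq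
      (T' := r.m * (16 + 3 + 1) + (3 + 1)) ?_))).mono ?_
    · refine hloop.of_eq (congrArg Regs.toState ?_) le_rfl rfl
      simp [σ, r', z, out, Regs.load, NatExpr.eval, Regs.toState]
    · simp only [NatExpr.cost]
      omega
  · change out r.m i = _
    simp only [out, if_pos hi, Nat.toNat_testBit]

end RealRAM

/-! ### The extraction program and its running time -/

namespace RealRAM

/-- The extraction program for the payoffs `g 0, …, g (N - 1)` of the `N` faces. -/
noncomputable def extractProgram (g : ℕ → ℝ) (N : ℕ) : Program :=
  .seq (tableProgram g N) <|
  .seq initProgram <|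
  .seq (.loop (.natLt (.var 5) (.var 0)) stepProgram)
    outputProgram

variable {F : Type*} [Fintype F]

/-- The payoff of the face with the given number. -/
noncomputable def payoff (ψ : F → ℝ) (i : ℕ) : ℝ :=
  if h : i < Fintype.card F then ψ ((Fintype.equivFin F).symm ⟨i, h⟩) else 0

theorem payoff_equivFin (ψ : F → ℝ) (f : F) : payoff ψ (Fintype.equivFin F f) = ψ f := by
  simp [payoff]

/-- The initial contents of the registers. -/
noncomputable def inputRegs {n : ℕ} (m : ℕ) (x : Fin n → F) : Regs where
  n := n
  m := m
  count := 0
  hi := 0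
  lo := 0
  time := 0
  idx := 0
  code := 0
  acc := 0
  val := 0
  sample i := if h : i < n then (Fintype.equivFin F (x ⟨i, h⟩) : ℕ) else 0
  out _ := 0
  start _ := 0
  len _ := 0
  table _ := 0
  mass _ := 0

theorem inputState_eq {n : ℕ} (m : ℕ) (x : Fin n → F) :
    inputState m x = (inputRegs m x).toState := by
  simp only [inputState, Regs.toState, inputRegs, State.mk.injEq]
  refine ⟨?_, ?_, ?_, ?_⟩ <;> funext i
  · rcases i with _ | _ | _ | _ | _ | _ | _ | _ | i <;> simp
  · rcases i with _ | _ | _ | _ | i <;> simp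
  · rcases i with _ | _ | i <;> rfl
  · rcases i with _ | _ | i <;> rfl

/-- The point that is output after the samples `l`. -/
noncomputable def outputCode (ψ : F → ℝ) (m : ℕ) (l : List F) : ℕ :=
  (Pieces.run m (l.map ψ)).start ((Pieces.run m (l.map ψ)).median - 1)

/-- The cost per sample is linear in the number of pieces, which is bounded both by `n + 1` and by
the number `2 ^ m` of points; the two bounds give the two running times. -/
theorem exists_runs_extractProgram {ψ : F → ℝ} (hψ : ∀ f, |ψ f| ≤ 1) {n m : ℕ} (hmn : m ≤ n)
    (hn : 1 ≤ n) (x : Fin n → F) :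
    ∃ s, Runs (extractProgram (payoff ψ) (Fintype.card F)) (inputState m x)
        ((3 * Fintype.card F + 244) * (n * min (n + 1) (2 ^ m))) s ∧
      ∀ i < m, s.natArr 1 i = ((outputCode ψ m (List.ofFn x)).testBit i).toNat := by
  set N := Fintype.card F
  set B := min (n + 1) (2 ^ m)
  let l : List ℝ := (List.ofFn x).map ψ
  have hlen : l.length = n := by simp [l]
  have hvalid : ∀ t, (Pieces.run m (l.take t)).Valid m := fun t =>
    Pieces.valid_run m fun v hv => by
      obtain ⟨f, -, rfl⟩ := List.mem_map.1 (List.mem_of_mem_take hv)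
      exact hψ f
  have hcount : ∀ t, (Pieces.run m (l.take t)).count ≤ B := fun t => by
    refine le_min ((Pieces.count_run_le m _).trans ?_) (hvalid t).count_le
    rw [List.length_take, hlen]
    omega
  let r₀ := inputRegs m x
  let r₁ : Regs := { r₀ with table := fun i => if i < N then payoff ψ i else r₀.table i }
  have htable : Runs (tableProgram (payoff ψ) N) (inputState m x) (3 * N + 1) r₁.toState := by
    rw [inputState_eq]
    exact runs_tableProgram r₀ (payoff ψ) N
  have hinit : Runs initProgram r₁.toState (15 * m + 14)
      ({ r₁ with idx := m }.load (Pieces.init m)).toState :=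
    runs_initProgram r₁ rfl rfl rfl
  have hvalue : ∀ t (ht : t < n), r₁.table (r₁.sample t) = l[t]'(hlen.symm ▸ ht) := by
    intro t ht
    have hs : r₁.sample t = (Fintype.equivFin F (x ⟨t, ht⟩) : ℕ) := by
      simp [r₁, r₀, inputRegs, ht]
    rw [hs]
    simp [r₁, l, N, payoff_equivFin]
  obtain ⟨s, hloop, r, hrm, hrs⟩ := Runs.loop_of_invariant (b := .natLt (.var 5) (.var 0))
    (p := stepProgram) (T := 42 * B + 101) (N := n)
    (s := ({ r₁ with idx := m }.load (Pieces.init m)).toState)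
    (fun t s => ∃ r : Regs, r.m = m ∧ s = (r.load (Pieces.run m (l.take t))).toState ∧
      r.n = n ∧ r.time = t ∧ r.sample = r₁.sample ∧ r.table = r₁.table)
    (by
      rintro t ht s ⟨r, -, rfl, hrn, hrt, -, -⟩
      change r.time < r.n
      omega)
    (by
      rintro s ⟨r, -, rfl, hrn, hrt, -, -⟩
      change ¬ r.time < r.n
      omega)
    (by
      rintro t ht s ⟨r, hrm, rfl, hrn, hrt, hrs, hrtab⟩
      have hstep := (runs_stepProgram (hvalid t) r).mono
        (show _ ≤ 42 * B + 101 by have := hcount t; omega)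
      refine ⟨_, hstep, _, ?_, congrArg (fun D => (Regs.load _ D).toState) ?_, ?_, ?_, ?_, ?_⟩
      rotate_left
      · rw [hrs, hrtab, hrt, hvalue t ht, List.take_succ_eq_append_getElem (hlen.symm ▸ ht),
          Pieces.run_append]
      · exact hrn
      · exact congrArg (· + 1) hrt
      · exact hrs
      · exact hrtab
      · exact hrm)
    ⟨{ r₁ with idx := m }, rfl, by simp [Pieces.run], rfl, rfl, rfl, rfl⟩
  have htake : l.take n = l := List.take_of_length_le hlen.le
  obtain ⟨s', hout, hbits⟩ := exists_runs_outputProgram (hvalid n) r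
  refine ⟨s', (htable.seq (hinit.seq (hloop.seq (hrs.1 ▸ hout)))).mono ?_, fun i hi => ?_⟩
  -- Here `244 = 42 + 105 + 35 + 13 + 49`: the coefficients of `n * B`, `n`, `m`, `B` and `1`, each
  -- quantity being at most `n * B`.
  · rw [hrm]
    have h1 := hcount n
    have hB : 1 ≤ B := le_min (by omega) Nat.one_le_two_pow
    have h2 : n ≤ n * B := Nat.le_mul_of_pos_right n hB
    have h3 : B ≤ n * B := Nat.le_mul_of_pos_left B hn
    have h4 : N ≤ N * (n * B) := Nat.le_mul_of_pos_right N (by positivity)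
    simp only [Cond.cost, NatExpr.cost]
    ring_nf
    ring_nf at h4
    omega
  · rw [hbits i (hrm ▸ hi), htake]
    rfl

/-- Bit strings of length `m` as numbers below `2 ^ m`, the least significant bit first. -/
def bitsEquiv (m : ℕ) : (Fin m → Bool) ≃ Fin (2 ^ m) where
  toFun y := ⟨Nat.ofBits y, Nat.ofBits_lt_two_pow y⟩
  invFun z i := (z : ℕ).testBit i
  left_inv y := by
    funext i
    simp
  right_inv z := by
    ext
    simp [Nat.ofBits_testBit, Nat.mod_eq_of_lt z.2]

/-- The function computed by the extraction program. -/
noncomputable def extractor (ψ : F → ℝ) (n m : ℕ) (x : Fin n → F) : Fin m → Bool :=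
  fun i => (outputCode ψ m (List.ofFn x)).testBit i

end RealRAM

/-! ### Choice of the number of samples and conclusion -/

namespace GSVSource

open RealRAM

variable {F : Type*} [Fintype F] (S : GSVSource F)

theorem isExtractor_extractor {ψ : F → ℝ} (hψ : ∀ f, |ψ f| ≤ 1) {σ : ℝ} (hσ1 : σ ≤ 1)
    (h : ∀ d ∈ S.dice, dieMean d ψ = 0 ∧ σ ≤ dieVar d ψ) {ε : ℝ} {n m : ℕ}
    (hε : 2 * 2 ^ m * (1 - σ / 1024) ^ n ≤ ε) : S.IsExtractor ε (extractor ψ n m) := by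
  intro A hA
  have hvalid : ∀ l : List F, (Pieces.run m (l.map ψ)).Valid m := fun l =>
    Pieces.valid_run m fun v hv => by
      obtain ⟨f, -, rfl⟩ := List.mem_map.1 hv
      exact hψ f
  let out : List F → Fin (2 ^ m) := fun l => ⟨outputCode ψ m l, (hvalid l).start_median_pred_lt⟩
  have herr := (Pieces.martingale hψ m).output_error_le (A := A) (out := out)
    (fun l => S.isDistribution _ (hA l)) (fun l => (h _ (hA l)).1) hψ hσ1
    (fun l => (h _ (hA l)).2)
    (fun l y hy => Fin.ext ((hvalid l).start_median_pred_eq y.2 hy)) n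
  have hprob : ∀ y, outputProb (extractor ψ n m) A y =
      stratExp A n (fun l => if out l = bitsEquiv m y then 1 else 0) := by
    intro y
    rw [outputProb, Finset.sum_filter, stratExp]
    refine Finset.sum_congr rfl fun x _ => ?_
    have : extractor ψ n m x = y ↔ out (List.ofFn x) = bitsEquiv m y :=
      (bitsEquiv m).symm_apply_eq (x := out (List.ofFn x)) (y := y)
    simp only [this, mul_ite, mul_one, mul_zero]
  simp only [hprob]
  rw [(bitsEquiv m).sum_comp fun z =>
    |stratExp A n (fun l => if out l = z then 1 else 0) - 1 / 2 ^ m|]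
  simp only [Fintype.card_fin, Nat.cast_pow, Nat.cast_ofNat] at herr
  exact herr.trans hε

/-- The factor `2 ^ m` in the error costs only `O(m)` further samples. The extra demands `n₀ ≤ n`
and `m ≤ n` are for the running time. -/
theorem exists_error_bound {β : ℝ} (hβ0 : 0 < β) (hβ1 : β ≤ 1) (n₀ : ℕ) : ∃ C : ℝ,
    ∀ (ε : ℝ) (m : ℕ), 0 < ε → ε < 1 → 1 ≤ m →
      ∃ n : ℕ, n₀ ≤ n ∧ m ≤ n ∧ (n : ℝ) ≤ C * (Real.log (1 / ε) + m) ∧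
        2 * 2 ^ m * (1 - β) ^ n ≤ ε := by
  refine ⟨n₀ + 2 + 2 / β, fun ε m hε0 hε1 hm => ?_⟩
  set L := Real.log (1 / ε) with hL
  have hL0 : 0 ≤ L := Real.log_nonneg (by rw [le_div_iff₀ hε0]; linarith)
  have hm' : (1 : ℝ) ≤ m := by exact_mod_cast hm
  have hceil0 : 0 ≤ (2 * m + L) / β := by positivity
  -- The last summand makes `(1 - β) ^ n ≤ exp (-(2 * m + L))`, and `2 * 2 ^ m ≤ exp (2 * m)` since
  -- `m ≥ 1`.
  refine ⟨n₀ + m + ⌈(2 * m + L) / β⌉₊, by omega, by omega, ?_, ?_⟩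
  · have h1 := (Nat.ceil_lt_add_one hceil0).le
    have h2 : (n₀ : ℝ) * 1 ≤ n₀ * (L + m) := by gcongr; linarith
    have h3 : (2 * m + L) / β ≤ 2 / β * (L + m) := by
      rw [div_mul_eq_mul_div]
      gcongr
      linarith
    push_cast
    linarith
  · have h1 := Nat.le_ceil ((2 * m + L) / β)
    set N := ⌈(2 * m + L) / β⌉₊
    have h2 : 2 * m + L ≤ β * N := by
      rw [div_le_iff₀ hβ0] at h1
      linarith
    have h3 : (1 - β) ^ (n₀ + m + N) ≤ Real.exp (-(2 * m + L)) := by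
      calc (1 - β) ^ (n₀ + m + N) ≤ (1 - β) ^ N :=
            pow_le_pow_of_le_one (by linarith) (by linarith) (by omega)
        _ ≤ Real.exp (-β) ^ N := by
            refine pow_le_pow_left₀ (by linarith) ?_ N
            linarith [Real.add_one_le_exp (-β)]
        _ = Real.exp (-(β * N)) := by rw [← Real.exp_nat_mul]; ring_nf
        _ ≤ _ := Real.exp_le_exp.2 (by linarith)
    have h4 : (2 : ℝ) * 2 ^ m ≤ Real.exp (2 * m) := by
      have : (2 : ℝ) ≤ Real.exp 1 := by linarith [Real.add_one_le_exp 1]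
      calc (2 : ℝ) * 2 ^ m = 2 ^ (m + 1) := by ring
        _ ≤ Real.exp 1 ^ (m + 1) := pow_le_pow_left₀ zero_le_two this _
        _ = Real.exp (m + 1) := by rw [← Real.exp_nat_mul]; push_cast; ring_nf
        _ ≤ _ := Real.exp_le_exp.2 (by linarith)
    calc 2 * 2 ^ m * (1 - β) ^ (n₀ + m + N)
        ≤ Real.exp (2 * m) * Real.exp (-(2 * m + L)) :=
          mul_le_mul h4 h3 (pow_nonneg (by linarith) _) (Real.exp_pos _).le
      _ = ε := by
          rw [← Real.exp_add, show (2 : ℝ) * m + -(2 * m + L) = -L by ring, hL, one_div,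
            Real.log_inv, neg_neg, Real.exp_log hε0]

theorem extractableLogarithmic_of_nkPlus (h : S.NKPlus) : S.ExtractableLogarithmic 3 := by
  obtain ⟨ψ, hψ, hdice⟩ := h
  have hψ' : ∀ f, |ψ f| ≤ 1 := fun f => abs_le.2 (hψ f)
  obtain ⟨d₀, hd₀, hmin⟩ := S.dice.exists_min_image (fun d => dieVar d ψ) S.dice_nonempty
  set σ := dieVar d₀ ψ
  have hσ0 : 0 < σ := (hdice d₀ hd₀).2
  have hσ1 : σ ≤ 1 := dieVar_le_one (S.isDistribution d₀ hd₀) hψ'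
  have hcard : 1 ≤ Fintype.card F := by
    refine Nat.one_le_iff_ne_zero.2 fun h0 => ?_
    have := Fintype.card_eq_zero_iff.1 h0
    simpa using S.die_sum hd₀
  set K := 3 * Fintype.card F + 244
  -- Having at least `2 * K` samples absorbs the constant of the running time into one more factor
  -- `n`.
  obtain ⟨C, hC⟩ := exists_error_bound (β := σ / 1024) (by positivity) (by linarith) (2 * K)
  refine ⟨extractProgram (payoff ψ) (Fintype.card F), C, K, fun ε m hε0 hε1 hm => ?_⟩
  obtain ⟨n, hKn, hmn, hnC, herr⟩ := hC ε m hε0 hε1 hm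
  refine ⟨n, extractor ψ n m, hnC, S.isExtractor_extractor hψ' hσ1
    (fun d hd => ⟨(hdice d hd).1, hmin d hd⟩) herr, fun x => ?_⟩
  have hn : 1 ≤ n := hm.trans hmn
  obtain ⟨s, ⟨t, ht, hexec⟩, hbits⟩ := exists_runs_extractProgram hψ' hmn hn x
  refine ⟨t, s, hexec, ht.trans (le_min ?_ ?_), fun i => hbits i i.2⟩
  · refine Nat.mul_le_mul_left K ?_
    rw [mul_assoc]
    exact Nat.mul_le_mul_left n ((min_le_right _ _).trans (Nat.le_mul_of_pos_left _ hm))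
  -- The time is cubic in `n`, so `c = 3` works because there is at least one face.
  · calc K * (n * min (n + 1) (2 ^ m)) ≤ K * (n * (2 * n)) := by
          gcongr
          exact (min_le_left _ _).trans (by omega)
      _ = 2 * K * (n * n) := by ring
      _ ≤ n * (n * n) := by gcongr
      _ = n ^ 3 := by ring
      _ ≤ n ^ (3 * Fintype.card F) := Nat.pow_le_pow_right hn (by omega)

end GSVSource

theorem theorem2 :
    ∃ c : ℕ, ∀ (F : Type*) [Fintype F] (S : GSVSource F),
      List.TFAE [S.NKPlus, S.ExtractableSubquadratic, S.ExtractableLogarithmic c] := by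
  refine ⟨3, fun F _ S => ?_⟩
  tfae_have 1 → 3 := S.extractableLogarithmic_of_nkPlus
  tfae_have 3 → 2 := S.extractableSubquadratic_of_logarithmic
  tfae_have 2 → 1 := S.nkPlus_of_extractableSubquadratic
  tfae_finish
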